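/- **Model.** Let $n,d$ be integers with $d\ge 2$. The keys $\bm k_1,\dots,\bm k_n\in\mathbb R^{1\times d}$ are the rows of a random matrix $\bm K\in\mathbb R^{n\times d}$, and the query is $$\bm q=\bm\beta\bm K+\bm\epsilon\in\mathbb R^{1\times d},$$ where $\bm\beta$ is a deterministic vector in the simplex $\{\beta_i\ge 0,\ \sum_{i=1}^n\beta_i=1\}$ and $\bm\epsilon$ has i.i.d. $\mathcal N(0,\sigma^2)$ coordinates, $\sigma>0$, and is independent of $\bm K$. The relevant keys are $\mathcal M^*=\{i:\beta_i>0\}$, and $s=|\mathcal M^*|$. **Assumptions.** Fix constants $\kappa\ge 0$, $\tau\in[0,1)$ with $2\kappa+\tau<1$, and $c_0,c_4>1$, $C_1,c_5,c_6,c_7,v>0$. Suppose that $n>c_0d$ and: 1. The entries of $\bm K$ are square integrable with mean zero and variance one. All columns of $\bm K$ have the same covariance matrix $\bm\Sigma\in\mathbb R^{n\times n}$, which is positive definite. The $d\times n$ matrix $\bm Z=\bm K^\top\bm\Sigma^{-1/2}$ is spherically symmetric, that is, $\bm Z\bm Q$ has the same law as $\bm Z$ for every orthogonal $n\times n$ matrix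 $\bm Q$. For every integer $\tilde p$ with $c_0d<\tilde p\le n$ and every $d\times\tilde p$ submatrix $\tilde{\bm Z}$ of $\bm Z$, $$\mathbb P\left(\lambda_{\max}(\tilde p^{-1}\tilde{\bm Z}\tilde{\bm Z}^\top)>c_4\ \text{ or }\ \lambda_{\min}(\tilde p^{-1}\tilde{\bm Z}\tilde{\bm Z}^\top)<1/c_4\right)<\exp(-C_1d).$$ 2. For each coordinate $t\in\{1,\dots,d\}$ we have $\mathrm{var}(q_t)\le v$, and for every $i\in\mathcal M^*$, $\beta_i\ge c_5d^{-\kappa}$ and $\mathrm{cov}(\beta_i^{-1}q_t,K_{it})\ge c_6$. 3. $\lambda_{\max}(\bm\Sigma)\le c_7d^\tau$. **Conclusion.** There are constants $c,C,A>0$, depending only on $\kappa,\tau,c_0,c_4,C_1,c_5,c_6,c_7,v$, such that for all $d,n,s$ and all models as above, with probability at least $1-A\,s\exp(-Cd^{1-2\kappa}/\log d)$ the following two statements hold simultaneously: (i) $$\sum_{i=1}^n\mathbb 1\left(\bm q\bm k_i^\top\ge\min_{j\in\mathcal M^*}\bm q\bm k_j^\top\right)\le c\,n\,d^{2\kappa+\tau-1}.$$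 (ii) For every $c_2$ with $0<c_2\le 1-2\kappa-\tau$ and every integer $k\ge\lfloor c\,n\,d^{-c_2}\rfloor$, every set of the $\min(k,n)$ indices with the largest scores $\bm q\bm k_i^\top$ (ties broken arbitrarily) contains $\mathcal M^*$. -/

import Mathlib

open MeasureTheory ProbabilityTheory Matrix
open scoped MatrixOrder NNReal

noncomputable section

/-- Largest eigenvalue of a real symmetric matrix (nonempty index type). -/
def lamMax {m : Type*} [Fintype m] [DecidableEq m] (A : Matrix m m ℝ) : ℝ :=
  sSup (spectrum ℝ A)

/-- Smallest eigenvalue of a real symmetric matrix (nonempty index type). -/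
def lamMin {m : Type*} [Fintype m] [DecidableEq m] (A : Matrix m m ℝ) : ℝ :=
  sInf (spectrum ℝ A)

/-- The array of entries of a matrix; arrays carry the product sigma-algebra. -/
def entries {m k : Type*} (A : Matrix m k ℝ) : m → k → ℝ := fun i j => A i j

/-- The keys are the rows `K i` of `K`; the columns of `K` are the `d` samples of the vector of the
`n` keys, with covariance matrix `S`. Whitening the samples gives the `d × n` matrix
`Z = Kᵀ S^{-1/2}`. -/
def whiten {n d : ℕ} (S : Matrix (Fin n) (Fin n) ℝ) (K : Matrix (Fin n) (Fin d) ℝ) :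
    Matrix (Fin d) (Fin n) ℝ :=
  Kᵀ * (CFC.sqrt S)⁻¹

/-- `p⁻¹ Z' Z'ᵀ`, where `Z'` is the `d × p` submatrix of `Z` formed by the `p = #J` columns
in `J`. -/
def subGram {n d : ℕ} (Z : Matrix (Fin d) (Fin n) ℝ) (J : Finset (Fin n)) :
    Matrix (Fin d) (Fin d) ℝ :=
  ((J.card : ℝ)⁻¹) •
    (Z.submatrix id (Subtype.val : J → Fin n) * (Z.submatrix id (Subtype.val : J → Fin n))ᵀ)

/-- The query `q = β K + ε`. -/
def query {n d : ℕ} (β : Fin n → ℝ) (K : Matrix (Fin n) (Fin d) ℝ) (e : Fin d → ℝ) : Fin d → ℝ :=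
  β ᵥ* K + e

/-- The score `q kᵢᵀ` of key `i`. -/
def score {n d : ℕ} (K : Matrix (Fin n) (Fin d) ℝ) (q : Fin d → ℝ) (i : Fin n) : ℝ :=
  q ⬝ᵥ K i

/-- The index set of the relevant keys. -/
def relevant {n : ℕ} (β : Fin n → ℝ) : Finset (Fin n) :=
  {i | 0 < β i}

theorem relevant_nonempty {n : ℕ} {β : Fin n → ℝ} (hβ : β ∈ stdSimplex ℝ (Fin n)) :
    (relevant β).Nonempty := by
  by_contra h
  rw [Finset.not_nonempty_iff_eq_empty] at h
  have h0 : ∀ i, β i = 0 := by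
    intro i
    by_contra hi
    have : i ∈ relevant β := by
      simp only [relevant, Finset.mem_filter, Finset.mem_univ, true_and]
      exact lt_of_le_of_ne (hβ.1 i) (Ne.symm hi)
    simp [h] at this
  have h1 := hβ.2
  simp [h0] at h1

/-- The number of indices whose value is at least the minimum of `f` over the nonempty set `M`. -/
def countAboveMin {n : ℕ} (f : Fin n → ℝ) (M : Finset (Fin n)) (hM : M.Nonempty) : ℝ :=
  ∑ i : Fin n, if M.inf' hM f ≤ f i then 1 else 0

/-- `T` is a set of `k` indices (all of them if `n < k`) with the largest values of `f`; ties are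
broken arbitrarily. -/
def IsTopK {n : ℕ} (f : Fin n → ℝ) (k : ℕ) (T : Finset (Fin n)) : Prop :=
  T.card = min k n ∧ ∀ i ∈ T, ∀ j ∉ T, f j ≤ f i

/-- The noise: i.i.d. centred Gaussian coordinates of variance `σ²`, independent of the keys. -/
structure GaussianNoise {Ω : Type*} [MeasurableSpace Ω] (P : Measure Ω) {n d : ℕ}
    (K : Ω → Matrix (Fin n) (Fin d) ℝ) (ε : Ω → Fin d → ℝ) (σ : ℝ≥0) : Prop where
  sigma_pos : 0 < σ
  meas : Measurable ε
  law : ∀ t, P.map (fun ω => ε ω t) = gaussianReal 0 (σ ^ 2)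
  indep : iIndepFun (fun t ω => ε ω t) P
  indep_keys : IndepFun (fun ω => entries (K ω)) ε P

/-- Random keys with standardized entries, whose columns have mean zero and covariance matrix `S`,
and whose whitened matrix is spherically symmetric. -/
structure StandardizedKeys {Ω : Type*} [MeasurableSpace Ω] (P : Measure Ω) {n d : ℕ}
    (K : Ω → Matrix (Fin n) (Fin d) ℝ) (S : Matrix (Fin n) (Fin n) ℝ) : Prop where
  meas : Measurable (fun ω => entries (K ω))
  memLp : ∀ i t, MemLp (fun ω => K ω i t) 2 P
  mean_zero : ∀ i t, ∫ ω, K ω i t ∂P = 0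
  cov_eq : ∀ t i j, cov[fun ω => K ω i t, fun ω => K ω j t; P] = S i j
  unit_var : ∀ i, S i i = 1
  posDef : S.PosDef
  spherical : ∀ Q ∈ Matrix.orthogonalGroup (Fin n) ℝ,
    IdentDistrib (fun ω => entries (whiten S (K ω) * Q)) (fun ω => entries (whiten S (K ω))) P P

/-- Spectral concentration: for every `d × p` submatrix `Z'` of `Z` with `c₀ d < p ≤ n`, the
eigenvalues of `p⁻¹ Z' Z'ᵀ` lie in `[1 / c₄, c₄]` up to probability less than `exp (-C₁ d)`. -/
def SpectralConcentration {Ω : Type*} [MeasurableSpace Ω] (P : Measure Ω) {n d : ℕ}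
    (Z : Ω → Matrix (Fin d) (Fin n) ℝ) (c₀ c₄ C₁ : ℝ) : Prop :=
  ∀ J : Finset (Fin n), c₀ * d < J.card →
    P.real {ω | c₄ < lamMax (subGram (Z ω) J) ∨ lamMin (subGram (Z ω) J) < 1 / c₄}
      < Real.exp (-C₁ * d)

/-- Signal strength: the coordinates of the query have variance at most `v`, the positive weights
are at least `c₅ / d ^ κ`, and every relevant key has covariance at least `c₆` with the query
rescaled by its weight. -/
structure SignalStrength {Ω : Type*} [MeasurableSpace Ω] (P : Measure Ω) {n d : ℕ}
    (K : Ω → Matrix (Fin n) (Fin d) ℝ) (ε : Ω → Fin d → ℝ) (β : Fin n → ℝ)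
    (κ v c₅ c₆ : ℝ) : Prop where
  var_query : ∀ t, Var[fun ω => query β (K ω) (ε ω) t; P] ≤ v
  weight_ge : ∀ i ∈ relevant β, c₅ / (d : ℝ) ^ κ ≤ β i
  cov_ge : ∀ i ∈ relevant β, ∀ t,
    c₆ ≤ cov[fun ω => (β i)⁻¹ * query β (K ω) (ε ω) t, fun ω => K ω i t; P]

end

/-!
Write `Z` for the whitened `d × n` matrix and `kᵢ = Z aᵢ` with `aᵢ` the `i`-th column of `S^{1/2}`,
a unit vector. With `b = S^{1/2} β` the query is `q = Z b + ε` and the score of key `i` is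
`⟨Z aᵢ, Z b⟩ + ⟨Z aᵢ, ε⟩`. The number of scores above the minimum over the relevant keys is at most
the sum of the squared scores divided by the square of that minimum, so it is enough to bound the
former above and the latter below (`countAboveMin_score_le`). A set of top scores that misses a
relevant key would make this count larger than its size (`IsTopK.subset_of_countAboveMin_le`).

The vector of scores is `S^{1/2} Zᵀ q`. Spectral concentration for the full matrix and the bound on
the eigenvalues of `S` give `O (n d ^ τ |q|²)` for the sum of squares, and `|q|² = O (d)`: the noise
by a chi-square tail, and `|Z b|²` because by spherical symmetry `Z b` is distributed as `|b|` times
a column of `Z`, which is short by spectral concentration for about `c₀ d` columns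
(`SpectralConcentration.exists_col_tail`). Here `|b|² ≤ v` since `|b|² + σ²` is the variance of a
coordinate of the query.

For a relevant key, `⟨aᵢ, b⟩` is the covariance of the query with the key, at least
`c₅ c₆ d ^ (-κ)`. Splitting `b` along and across `aᵢ`, the score is `⟨aᵢ, b⟩ |Z aᵢ|²` plus two cross
terms. Spherical symmetry permits replacing a fixed direction by the direction of an independent
Gaussian vector `g`, after which one conditions on `Z` (`measureReal_le_of_forall_section`). In this
way `|Z aᵢ|²` is at least of order `d` up to probability `exp (-C d)`
(`SphericalLaw.normSq_mulVec_le_le`, resting on the lower tail `stdGauss_mulVec_normSq_le`), and the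
cross terms, conditionally Gaussian of variance `O (d)`, are below a small multiple of `d ^ (1 - κ)`
up to probability `exp (-C d ^ (1 - 2 κ))` (`SphericalLaw.abs_inner_mulVec_ge_le`,
`GaussianNoise.abs_inner_ge_le`). The scores of the relevant keys are then at least of order
`d ^ (1 - κ)`, and a union bound over the `s` relevant keys ends the argument; the division by
`log d` in the exponent is not needed.
-/

/-! ### Quadratic forms and eigenvalue bounds -/

/-- The spectrum is finite, so the supremum in `lamMax` is not a junk value. -/
theorem dotProduct_mulVec_le_lamMax {m : Type*} [Fintype m] [DecidableEq m] {A : Matrix m m ℝ}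
    (hA : A.IsHermitian) (x : m → ℝ) : x ⬝ᵥ A *ᵥ x ≤ lamMax A * (x ⬝ᵥ x) := by
  have hle : A ≤ algebraMap ℝ _ (lamMax A) :=
    le_algebraMap_of_spectrum_le
      (fun y hy => le_csSup (Matrix.finite_real_spectrum (A := A)).bddAbove hy) hA.isSelfAdjoint
  have h := (Matrix.le_iff.mp hle).dotProduct_mulVec_nonneg x
  rw [sub_mulVec, dotProduct_sub, Algebra.algebraMap_eq_smul_one, smul_mulVec, one_mulVec,
    dotProduct_smul] at h
  simpa using h

theorem lamMin_le_dotProduct_mulVec {m : Type*} [Fintype m] [DecidableEq m] {A : Matrix m m ℝ}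
    (hA : A.IsHermitian) (x : m → ℝ) : lamMin A * (x ⬝ᵥ x) ≤ x ⬝ᵥ A *ᵥ x := by
  have hle : algebraMap ℝ _ (lamMin A) ≤ A :=
    algebraMap_le_of_le_spectrum
      (fun y hy => csInf_le (Matrix.finite_real_spectrum (A := A)).bddBelow hy) hA.isSelfAdjoint
  have h := (Matrix.le_iff.mp hle).dotProduct_mulVec_nonneg x
  rw [sub_mulVec, dotProduct_sub, Algebra.algebraMap_eq_smul_one, smul_mulVec, one_mulVec,
    dotProduct_smul] at h
  simpa using h

theorem dotProduct_mul_transpose_mulVec {m k : Type*} [Fintype m] [Fintype k]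
    (Z : Matrix m k ℝ) (x : m → ℝ) : x ⬝ᵥ (Z * Zᵀ) *ᵥ x = (Zᵀ *ᵥ x) ⬝ᵥ (Zᵀ *ᵥ x) := by
  rw [← mulVec_mulVec, dotProduct_mulVec, ← mulVec_transpose]

theorem mulVec_dotProduct_comm {m k : Type*} [Fintype m] [Fintype k]
    (Z : Matrix m k ℝ) (x : k → ℝ) (y : m → ℝ) : (Z *ᵥ x) ⬝ᵥ y = x ⬝ᵥ (Zᵀ *ᵥ y) := by
  rw [dotProduct_comm, dotProduct_mulVec, ← mulVec_transpose, dotProduct_comm]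

theorem dotProduct_self_nonneg_real {m : Type*} [Fintype m] (x : m → ℝ) : 0 ≤ x ⬝ᵥ x :=
  Finset.sum_nonneg fun i _ => mul_self_nonneg (x i)

theorem dotProduct_sub_proj {m : Type*} [Fintype m] {a : m → ℝ} (ha : a ⬝ᵥ a = 1) (b : m → ℝ) :
    a ⬝ᵥ (b - (a ⬝ᵥ b) • a) = 0 := by
  rw [dotProduct_sub, dotProduct_smul, ha]
  simp

theorem normSq_sub_proj {m : Type*} [Fintype m] {a : m → ℝ} (ha : a ⬝ᵥ a = 1) (b : m → ℝ) :
    (b - (a ⬝ᵥ b) • a) ⬝ᵥ (b - (a ⬝ᵥ b) • a) = b ⬝ᵥ b - (a ⬝ᵥ b) ^ 2 := by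
  have h := dotProduct_comm b a
  simp only [dotProduct_sub, sub_dotProduct, smul_dotProduct, dotProduct_smul, smul_eq_mul, ha, h]
  ring

theorem normSq_sub_proj_le {m : Type*} [Fintype m] {a : m → ℝ} (ha : a ⬝ᵥ a = 1) (b : m → ℝ) :
    (b - (a ⬝ᵥ b) • a) ⬝ᵥ (b - (a ⬝ᵥ b) • a) ≤ b ⬝ᵥ b := by
  rw [normSq_sub_proj ha]
  linarith [sq_nonneg (a ⬝ᵥ b)]

/-! ### Tails of the standard Gaussian measure -/

/-- The standard Gaussian measure on `ℝⁿ`. -/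
noncomputable def stdGauss (n : ℕ) : Measure (Fin n → ℝ) := Measure.pi fun _ => gaussianReal 0 1

instance (n : ℕ) : IsProbabilityMeasure (stdGauss n) := by unfold stdGauss; infer_instance

theorem gaussianReal_exp_neg_mul_sq {b : ℝ} (hb : -(1 / 2) < b) :
    Integrable (fun x : ℝ => Real.exp (-b * x ^ 2)) (gaussianReal 0 1) ∧
      ∫ x, Real.exp (-b * x ^ 2) ∂gaussianReal 0 1 = (√(1 + 2 * b))⁻¹ := by
  have hpdf : ∀ x : ℝ, gaussianPDFReal 0 1 x * Real.exp (-b * x ^ 2) =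
      (√(2 * Real.pi))⁻¹ * Real.exp (-(b + 1 / 2) * x ^ 2) := by
    intro x
    simp only [gaussianPDFReal, NNReal.coe_one, mul_one, sub_zero]
    rw [mul_assoc, ← Real.exp_add]
    congr 2; ring
  constructor
  · rw [gaussianReal_of_var_ne_zero 0 one_ne_zero, gaussianPDF_def,
      integrable_withDensity_iff_integrable_smul₀' (by fun_prop) (by simp)]
    have : (fun x : ℝ => (ENNReal.ofReal (gaussianPDFReal 0 1 x)).toReal •
        Real.exp (-b * x ^ 2)) =
        fun x => (√(2 * Real.pi))⁻¹ * Real.exp (-(b + 1 / 2) * x ^ 2) := by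
      ext x
      rw [ENNReal.toReal_ofReal (gaussianPDFReal_nonneg _ _ _), smul_eq_mul, hpdf]
    rw [this]
    exact (integrable_exp_neg_mul_sq (by linarith)).const_mul _
  · rw [integral_gaussianReal_eq_integral_smul one_ne_zero]
    simp_rw [smul_eq_mul, hpdf]
    rw [integral_const_mul, integral_gaussian, ← Real.sqrt_inv, ← Real.sqrt_mul (by positivity),
      ← Real.sqrt_inv]
    congr 1
    have hb' : 1 + 2 * b ≠ 0 := by linarith
    have hpi := Real.pi_ne_zero
    rw [show b + 1 / 2 = (1 + 2 * b) / 2 by ring]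
    field_simp

theorem stdGauss_exp_neg_mul_normSq (n : ℕ) {b : ℝ} (hb : -(1 / 2) < b) :
    Integrable (fun g : Fin n → ℝ => Real.exp (-b * (g ⬝ᵥ g))) (stdGauss n) ∧
      ∫ g, Real.exp (-b * (g ⬝ᵥ g)) ∂stdGauss n = (√(1 + 2 * b))⁻¹ ^ n := by
  have : (fun g : Fin n → ℝ => Real.exp (-b * (g ⬝ᵥ g))) =
      fun g => ∏ i, Real.exp (-b * g i ^ 2) := by
    ext g
    rw [← Real.exp_sum, dotProduct, Finset.mul_sum]
    simp only [sq]
  obtain ⟨h1, h2⟩ := gaussianReal_exp_neg_mul_sq hb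
  rw [this]
  constructor
  · exact Integrable.fintype_prod (fun _ => h1)
  · rw [stdGauss, integral_fintype_prod_eq_prod (f := fun _ x => Real.exp (-b * x ^ 2))]
    simp_rw [h2]
    simp

theorem stdGauss_cexp (n : ℕ) (x : Fin n → ℝ) :
    ∫ g, Complex.exp (((x ⬝ᵥ g : ℝ) : ℂ) * Complex.I) ∂stdGauss n =
      ((Real.exp (-(x ⬝ᵥ x) / 2) : ℝ) : ℂ) := by
  have : (fun g : Fin n → ℝ => Complex.exp (((x ⬝ᵥ g : ℝ) : ℂ) * Complex.I)) =
      fun g => ∏ i, Complex.exp ((x i : ℂ) * (g i : ℂ) * Complex.I) := by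
    ext g
    rw [← Complex.exp_sum, dotProduct]
    push_cast
    rw [Finset.sum_mul]
  rw [this, stdGauss, integral_fintype_prod_eq_prod
    (f := fun i (y : ℝ) => Complex.exp ((x i : ℂ) * (y : ℂ) * Complex.I))]
  have h : ∀ i, ∫ y, Complex.exp ((x i : ℂ) * (y : ℂ) * Complex.I) ∂gaussianReal 0 1 =
      Complex.exp (-((x i : ℂ) ^ 2) / 2) := by
    intro i
    rw [← charFun_apply_real, charFun_gaussianReal]
    congr 1; simp; ring
  simp_rw [h]
  rw [← Complex.exp_sum]
  push_cast
  congr 1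
  rw [dotProduct, ← Finset.sum_div, Finset.sum_neg_distrib]
  push_cast
  simp [sq]

/-- Gaussian duality: `exp (-|Z g|² / 2)` is the mean of `exp (i ⟨h, Z g⟩)` over a Gaussian `h`, and
`⟨h, Z g⟩ = ⟨Zᵀ h, g⟩`, so by Fubini `Z` may be replaced by its transpose. This gives the Laplace
transform of `|Z g|²` from bounds on `Z Zᵀ` without diagonalizing. -/
theorem stdGauss_exp_neg_mulVec_swap {d n : ℕ} (Z : Matrix (Fin d) (Fin n) ℝ) :
    ∫ g, Real.exp (-((Z *ᵥ g) ⬝ᵥ (Z *ᵥ g)) / 2) ∂stdGauss n =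
      ∫ h, Real.exp (-((Zᵀ *ᵥ h) ⬝ᵥ (Zᵀ *ᵥ h)) / 2) ∂stdGauss d := by
  apply Complex.ofReal_injective
  rw [← integral_complex_ofReal, ← integral_complex_ofReal]
  simp_rw [← stdGauss_cexp]
  rw [integral_integral_swap]
  · congr 1; ext h; congr 1; ext g
    rw [mulVec_dotProduct_comm, dotProduct_comm]
  · apply Integrable.of_bound (C := 1)
    · apply Continuous.aestronglyMeasurable
      unfold Function.uncurry
      simp only [dotProduct, mulVec]
      fun_prop
    · filter_upwards with p
      simp [Function.uncurry, Complex.norm_exp]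

theorem stdGauss_exp_linear (n : ℕ) (x : Fin n → ℝ) :
    Integrable (fun g => Real.exp (x ⬝ᵥ g)) (stdGauss n) ∧
    ∫ g, Real.exp (x ⬝ᵥ g) ∂stdGauss n = Real.exp ((x ⬝ᵥ x) / 2) := by
  have : (fun g : Fin n → ℝ => Real.exp (x ⬝ᵥ g)) = fun g => ∏ i, Real.exp (x i * g i) := by
    ext g
    rw [← Real.exp_sum, dotProduct]
  rw [this]
  constructor
  · exact Integrable.fintype_prod (fun i => integrable_exp_mul_gaussianReal (x i))
  · rw [stdGauss, integral_fintype_prod_eq_prod (f := fun i (y : ℝ) => Real.exp (x i * y))]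
    have h : ∀ i, ∫ y, Real.exp (x i * y) ∂gaussianReal 0 1 = Real.exp (x i ^ 2 / 2) := by
      intro i
      have := mgf_gaussianReal (p := gaussianReal 0 1) (X := id) (μ := 0) (v := 1) (by simp) (x i)
      simpa [mgf] using this
    simp_rw [h]
    rw [← Real.exp_sum, dotProduct, Finset.sum_div]
    simp [sq]

theorem stdGauss_normSq_ge (n : ℕ) :
    (stdGauss n).real {g | 4 * (n : ℝ) ≤ g ⬝ᵥ g} ≤ Real.exp (-(n : ℝ) / 2) := by
  obtain ⟨h1, h2⟩ := stdGauss_exp_neg_mul_normSq n (b := -(1 / 4)) (by norm_num)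
  have h := measure_ge_le_exp_mul_mgf (μ := stdGauss n) (X := fun g => g ⬝ᵥ g) (t := 1 / 4)
    (4 * n) (by norm_num) (by simpa using h1)
  refine h.trans ?_
  have h3 : mgf (fun g : Fin n → ℝ => g ⬝ᵥ g) (stdGauss n) (1 / 4) = √2 ^ n := by
    rw [mgf]
    convert h2 using 2
    · simp
    · rw [← Real.sqrt_inv]; norm_num
  rw [h3]
  have h4 : √2 ≤ Real.exp (1 / 2) := by
    rw [Real.sqrt_le_left (Real.exp_pos _).le, ← Real.exp_nat_mul]
    have := Real.add_one_le_exp (1 : ℝ)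
    norm_num at this ⊢
    linarith
  calc Real.exp (-(1 / 4) * (4 * n)) * √2 ^ n
      ≤ Real.exp (-(1 / 4) * (4 * n)) * Real.exp (1 / 2) ^ n := by gcongr
    _ = Real.exp (-(n : ℝ) / 2) := by
        rw [← Real.exp_nat_mul, ← Real.exp_add]; congr 1; ring

/-- If `Z Zᵀ ≥ m`, then `|Z g|²` has the lower tail of `m` times a chi-square variable with `d`
degrees of freedom: by duality its Laplace transform at `1 / m` is at most `3 ^ (-d / 2)`. -/
theorem stdGauss_mulVec_normSq_le {d n : ℕ} {Z : Matrix (Fin d) (Fin n) ℝ} {m : ℝ} (hm : 0 < m)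
    (hZ : ∀ x, m * (x ⬝ᵥ x) ≤ (Zᵀ *ᵥ x) ⬝ᵥ (Zᵀ *ᵥ x)) :
    (stdGauss n).real {g | (Z *ᵥ g) ⬝ᵥ (Z *ᵥ g) ≤ m * d / 4} ≤ Real.exp (-(d : ℝ) / 4) := by
  have hint : ∀ {k l : ℕ} (W : Matrix (Fin k) (Fin l) ℝ),
      Integrable (fun g => Real.exp (-((W *ᵥ g) ⬝ᵥ (W *ᵥ g)) / 2)) (stdGauss l) := by
    intro k l W
    apply Integrable.of_bound (C := 1)
    · apply Continuous.aestronglyMeasurable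
      simp only [dotProduct, mulVec]
      fun_prop
    · filter_upwards with g
      have := dotProduct_self_nonneg_real (W *ᵥ g)
      rw [Real.norm_eq_abs, Real.abs_exp, Real.exp_le_one_iff]
      linarith
  -- scaling by `√(2 / m)` turns the factor `1 / 2` of the duality formula into `1 / m`
  set c := √(2 / m)
  have hc : c * c = 2 / m := Real.mul_self_sqrt (by positivity)
  have hsm : ∀ {k l : ℕ} (W : Matrix (Fin k) (Fin l) ℝ) (g : Fin l → ℝ),
      -(((c • W) *ᵥ g) ⬝ᵥ ((c • W) *ᵥ g)) / 2 = -(1 / m) * ((W *ᵥ g) ⬝ᵥ (W *ᵥ g)) := by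
    intro k l W g
    rw [smul_mulVec, smul_dotProduct, dotProduct_smul, smul_eq_mul, smul_eq_mul, ← mul_assoc, hc]
    ring
  have hswap := stdGauss_exp_neg_mulVec_swap (c • Z)
  have hi1 := hint (c • Z)
  have hi2 := hint ((c • Z)ᵀ)
  rw [transpose_smul] at hswap hi2
  simp_rw [hsm] at hswap hi1 hi2
  obtain ⟨h1, h2⟩ := stdGauss_exp_neg_mul_normSq d (b := 1) (by norm_num)
  have h := measure_le_le_exp_mul_mgf (μ := stdGauss n) (X := fun g => (Z *ᵥ g) ⬝ᵥ (Z *ᵥ g))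
    (t := -(1 / m)) (m * d / 4) (by have := one_div_pos.mpr hm; linarith) hi1
  refine h.trans ?_
  have h3 : (√3)⁻¹ ≤ Real.exp (-(1 / 2)) := by
    rw [Real.exp_neg]
    gcongr
    apply Real.le_sqrt_of_sq_le
    rw [← Real.exp_nat_mul]
    have := Real.exp_one_lt_three
    norm_num
    linarith
  have h4 : mgf (fun g => (Z *ᵥ g) ⬝ᵥ (Z *ᵥ g)) (stdGauss n) (-(1 / m)) ≤
      Real.exp (-(1 / 2)) ^ d := by
    rw [mgf, hswap]
    calc _ ≤ ∫ g, Real.exp (-1 * (g ⬝ᵥ g)) ∂stdGauss d := by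
          refine integral_mono hi2 h1 fun g => Real.exp_le_exp.mpr ?_
          have := hZ g
          have h5 : g ⬝ᵥ g = 1 / m * (m * (g ⬝ᵥ g)) := by field_simp
          have h6 : 1 / m * (m * (g ⬝ᵥ g)) ≤ 1 / m * ((Zᵀ *ᵥ g) ⬝ᵥ (Zᵀ *ᵥ g)) := by gcongr
          simp only [neg_mul, one_mul, neg_le_neg_iff]
          linarith
      _ = (√3)⁻¹ ^ d := by rw [h2]; norm_num
      _ ≤ _ := by gcongr
  calc _ ≤ Real.exp (-(-(1 / m)) * (m * d / 4)) * Real.exp (-(1 / 2)) ^ d := by gcongr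
    _ = Real.exp (-(d : ℝ) / 4) := by
        rw [← Real.exp_nat_mul, ← Real.exp_add]; congr 1; field_simp; ring

theorem stdGauss_normSq_le (n : ℕ) :
    (stdGauss n).real {g | g ⬝ᵥ g ≤ (n : ℝ) / 4} ≤ Real.exp (-(n : ℝ) / 4) := by
  simpa using stdGauss_mulVec_normSq_le (Z := (1 : Matrix (Fin n) (Fin n) ℝ)) one_pos
    (fun x => by simp)

theorem stdGauss_linear_ge {n : ℕ} {x : Fin n → ℝ} {V t : ℝ} (hV : 0 < V) (hx : x ⬝ᵥ x ≤ V)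
    (ht : 0 ≤ t) : (stdGauss n).real {g | t ≤ x ⬝ᵥ g} ≤ Real.exp (-t ^ 2 / (2 * V)) := by
  have hsm : ∀ g, t / V * (x ⬝ᵥ g) = (((t / V) • x) ⬝ᵥ g) := by
    intro g; rw [smul_dotProduct, smul_eq_mul]
  obtain ⟨h1, h2⟩ := stdGauss_exp_linear n ((t / V) • x)
  have h := measure_ge_le_exp_mul_mgf (μ := stdGauss n) (X := fun g => x ⬝ᵥ g) (t := t / V)
    t (by positivity) (by simpa only [hsm] using h1)
  refine h.trans ?_
  rw [mgf]
  simp_rw [hsm]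
  rw [h2, ← Real.exp_add, Real.exp_le_exp, smul_dotProduct, dotProduct_smul, smul_eq_mul,
    smul_eq_mul]
  have h3 : t / V * (t / V * (x ⬝ᵥ x)) ≤ t / V * (t / V * V) := by gcongr
  have h4 : t / V * (t / V * V) = t ^ 2 / V := by field_simp
  have h5 : -t ^ 2 / (2 * V) = - (t ^ 2 / V) + t ^ 2 / V / 2 := by field_simp; ring
  have h6 : -(t / V) * t = - (t ^ 2 / V) := by ring
  rw [h5, h6]
  linarith

theorem stdGauss_abs_linear_ge {n : ℕ} {x : Fin n → ℝ} {V t : ℝ} (hV : 0 < V) (hx : x ⬝ᵥ x ≤ V)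
    (ht : 0 ≤ t) : (stdGauss n).real {g | t ≤ |x ⬝ᵥ g|} ≤ 2 * Real.exp (-t ^ 2 / (2 * V)) := by
  have h1 := stdGauss_linear_ge hV hx ht
  have h2 := stdGauss_linear_ge (x := -x) hV (by simpa using hx) ht
  calc _ ≤ (stdGauss n).real ({g | t ≤ x ⬝ᵥ g} ∪ {g | t ≤ (-x) ⬝ᵥ g}) := by
        refine measureReal_mono (fun g hg => ?_) (measure_ne_top _ _)
        simpa [le_abs] using hg
    _ ≤ _ := measureReal_union_le _ _
    _ ≤ _ := by linarith

/-! ### Orthogonal invariance and randomization -/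

/-- Two vectors of equal length and equal inner product with `a` are exchanged by an orthogonal
matrix fixing `a`, namely the reflection in the hyperplane orthogonal to their difference. -/
theorem exists_orthogonal_mulVec_eq {n : ℕ} {a w w' : Fin n → ℝ} (hn : w ⬝ᵥ w = w' ⬝ᵥ w')
    (ha : a ⬝ᵥ w = a ⬝ᵥ w') :
    ∃ Q ∈ Matrix.orthogonalGroup (Fin n) ℝ, Q *ᵥ a = a ∧ Q *ᵥ w = w' := by
  by_cases hw : w = w'
  · exact ⟨1, one_mem _, by simp, by simp [hw]⟩
  set v := w - w' with hv
  have hv0 : v ⬝ᵥ v ≠ 0 := by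
    rw [Ne, dotProduct_self_eq_zero]
    exact sub_ne_zero.mpr hw
  set c := 2 / (v ⬝ᵥ v) with hc
  have hmul : ∀ x, (1 - c • vecMulVec v v) *ᵥ x = x - (c * (v ⬝ᵥ x)) • v := by
    intro x
    rw [sub_mulVec, one_mulVec, smul_mulVec, vecMulVec_mulVec]
    ext i
    simp
    ring
  refine ⟨1 - c • vecMulVec v v, ?_, ?_, ?_⟩
  · have hT : (1 - c • vecMulVec v v)ᵀ = 1 - c • vecMulVec v v := by
      rw [transpose_sub, transpose_one, transpose_smul, transpose_vecMulVec]
    rw [Matrix.mem_orthogonalGroup_iff, hT]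
    apply Matrix.ext_of_mulVec_single
    intro i
    rw [← mulVec_mulVec, hmul, hmul, one_mulVec]
    set x : Fin n → ℝ := Pi.single i 1
    have : v ⬝ᵥ (x - (c * (v ⬝ᵥ x)) • v) = - (v ⬝ᵥ x) := by
      rw [dotProduct_sub, dotProduct_smul, smul_eq_mul, hc]
      field_simp
      ring
    rw [this]
    ext j
    simp
  · rw [hmul]
    have : v ⬝ᵥ a = 0 := by
      rw [dotProduct_comm, hv, dotProduct_sub, ha, sub_self]
    simp [this]
  · rw [hmul]
    have h2 : v ⬝ᵥ v = 2 * (v ⬝ᵥ w) := by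
      have h3 := dotProduct_comm w w'
      simp only [hv, dotProduct_sub, sub_dotProduct]
      linarith
    have h1 : c * (v ⬝ᵥ w) = 1 := by
      rw [hc, h2]
      rw [h2] at hv0
      have : v ⬝ᵥ w ≠ 0 := by
        intro h
        simp [h] at hv0
      field_simp
    rw [h1, hv]
    simp

theorem prod_measureReal_le_of_forall_section {X Y : Type*} [MeasurableSpace X]
    [MeasurableSpace Y] {μ : Measure X} {γ : Measure Y} [IsProbabilityMeasure μ]
    [IsProbabilityMeasure γ] {R : Set (X × Y)} {δ : ℝ} (hR : MeasurableSet R)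
    (h : ∀ x, γ.real {y | (x, y) ∈ R} ≤ δ) : (μ.prod γ).real R ≤ δ := by
  have hδ : 0 ≤ δ := by
    obtain ⟨x⟩ := μ.nonempty_of_neZero
    exact measureReal_nonneg.trans (h x)
  refine ENNReal.toReal_le_of_le_ofReal hδ ?_
  rw [Measure.prod_apply hR]
  calc _ ≤ ∫⁻ _, ENNReal.ofReal δ ∂μ := by
        refine lintegral_mono fun x => ?_
        exact (ENNReal.le_ofReal_iff_toReal_le (measure_ne_top _ _) hδ).mpr (h x)
    _ = _ := by simp

/-- Averaging over an auxiliary random `y`: if `A` is at most as likely as the section of `R` at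
every `y` outside `N`, then Fubini bounds `A` through the sections of `R` at the points `x`. -/
theorem measureReal_le_of_forall_section {X Y : Type*} [MeasurableSpace X] [MeasurableSpace Y]
    {μ : Measure X} {γ : Measure Y} [IsProbabilityMeasure μ] [IsProbabilityMeasure γ]
    {A : Set X} {R : Set (X × Y)} {N : Set Y} {δ : ℝ}
    (hR : MeasurableSet R) (hN : MeasurableSet N)
    (h1 : ∀ y, y ∉ N → μ.real A ≤ μ.real {x | (x, y) ∈ R})
    (h2 : ∀ x, γ.real {y | (x, y) ∈ R} ≤ δ) :
    μ.real A ≤ γ.real N + δ := by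
  have hR1 : (μ.prod γ).real R ≤ δ := prod_measureReal_le_of_forall_section hR h2
  have hE : μ A ≤ γ N + (μ.prod γ) R := by
    rw [Measure.prod_apply_symm hR, ← lintegral_indicator_one hN,
      ← lintegral_add_left (measurable_one.indicator hN)]
    calc μ A = ∫⁻ _, μ A ∂γ := by simp
      _ ≤ _ := by
        refine lintegral_mono fun y => ?_
        by_cases hy : y ∈ N
        · simp only [Set.indicator_of_mem hy, Pi.one_apply]
          exact prob_le_one.trans le_self_add
        · simp only [Set.indicator_of_notMem hy, zero_add]
          exact (ENNReal.toReal_le_toReal (measure_ne_top _ _) (measure_ne_top _ _)).mp (h1 y hy)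
  have := ENNReal.toReal_mono (by finiteness) hE
  rw [ENNReal.toReal_add (by finiteness) (by finiteness)] at this
  exact this.trans (add_le_add le_rfl hR1)

/-- The eigenvalues of `Z Zᵀ` lie in `[m, M]`, phrased through the quadratic form `|Zᵀ x|²`. -/
def GramBounds {d n : ℕ} (m M : ℝ) (Z : Matrix (Fin d) (Fin n) ℝ) : Prop :=
  ∀ x, m * (x ⬝ᵥ x) ≤ (Zᵀ *ᵥ x) ⬝ᵥ (Zᵀ *ᵥ x) ∧ (Zᵀ *ᵥ x) ⬝ᵥ (Zᵀ *ᵥ x) ≤ M * (x ⬝ᵥ x)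

theorem GramBounds.mul_orthogonal {d n : ℕ} {m M : ℝ} {Z : Matrix (Fin d) (Fin n) ℝ}
    {Q : Matrix (Fin n) (Fin n) ℝ} (hQ : Q ∈ Matrix.orthogonalGroup (Fin n) ℝ) :
    GramBounds m M (Z * Q) ↔ GramBounds m M Z := by
  have h : ∀ x, ((Z * Q)ᵀ *ᵥ x) ⬝ᵥ ((Z * Q)ᵀ *ᵥ x) = (Zᵀ *ᵥ x) ⬝ᵥ (Zᵀ *ᵥ x) := by
    intro x
    have hQ' := (Matrix.mem_orthogonalGroup_iff _ _).mp hQ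
    rw [← dotProduct_mul_transpose_mulVec, ← dotProduct_mul_transpose_mulVec, transpose_mul,
      ← Matrix.mul_assoc, Matrix.mul_assoc Z, hQ', Matrix.mul_one]
  simp only [GramBounds, h]

theorem isClosed_gramBounds {d n : ℕ} (m M : ℝ) :
    IsClosed {Z : Fin d → Fin n → ℝ | GramBounds m M (of Z)} := by
  simp only [GramBounds, Set.ofPred_forall, Set.ofPred_and]
  refine isClosed_iInter fun x => ?_
  refine (isClosed_le ?_ ?_).inter (isClosed_le ?_ ?_) <;>
  · simp only [dotProduct, mulVec, transpose_apply, of_apply]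
    fun_prop

/-- The law `μ` of a random matrix, given as an array of entries, is invariant under right
multiplication by orthogonal matrices. -/
def SphericalLaw {d n : ℕ} (μ : Measure (Fin d → Fin n → ℝ)) : Prop :=
  ∀ Q ∈ Matrix.orthogonalGroup (Fin n) ℝ, μ.map (fun Z => entries (of Z * Q)) = μ

theorem measurable_entries_mul {d n : ℕ} (Q : Matrix (Fin n) (Fin n) ℝ) :
    Measurable (fun Z : Fin d → Fin n → ℝ => entries (of Z * Q)) := by
  apply Continuous.measurable
  unfold entries
  simp only [Matrix.mul_apply, of_apply]
  fun_prop

/-- Under a spherical law, `(Z a, Z w)` and `(Z a, Z w')` are equally distributed when some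
orthogonal matrix fixes `a` and takes `w` to `w'`; this holds jointly with any bounds on `Z Zᵀ`. -/
theorem SphericalLaw.measureReal_eq {d n : ℕ} {μ : Measure (Fin d → Fin n → ℝ)}
    (hμ : SphericalLaw μ) {m M : ℝ} {p : (Fin d → ℝ) → (Fin d → ℝ) → Prop}
    (hp : MeasurableSet {x : (Fin d → ℝ) × (Fin d → ℝ) | p x.1 x.2})
    {a w w' : Fin n → ℝ} (hn : w ⬝ᵥ w = w' ⬝ᵥ w') (ha : a ⬝ᵥ w = a ⬝ᵥ w') :
    μ.real {Z | GramBounds m M (of Z) ∧ p (of Z *ᵥ a) (of Z *ᵥ w)} =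
      μ.real {Z | GramBounds m M (of Z) ∧ p (of Z *ᵥ a) (of Z *ᵥ w')} := by
  obtain ⟨Q, hQ, hQa, hQw⟩ := exists_orthogonal_mulVec_eq hn ha
  have hcont : ∀ u : Fin n → ℝ, Measurable fun Z : Fin d → Fin n → ℝ => of Z *ᵥ u := by
    intro u
    apply Continuous.measurable
    unfold mulVec
    simp only [dotProduct, of_apply]
    fun_prop
  have hmeas : MeasurableSet
      {Z : Fin d → Fin n → ℝ | GramBounds m M (of Z) ∧ p (of Z *ᵥ a) (of Z *ᵥ w)} :=
    (isClosed_gramBounds m M).measurableSet.inter (((hcont a).prodMk (hcont w)) hp)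
  conv_lhs => rw [← hμ Q hQ]
  rw [map_measureReal_apply (measurable_entries_mul Q) hmeas]
  congr 1
  ext Z
  have h1 : of (entries (of Z * Q)) = of Z * Q := rfl
  simp only [Set.mem_preimage, Set.mem_ofPred_eq]
  rw [h1, GramBounds.mul_orthogonal hQ, ← mulVec_mulVec, ← mulVec_mulVec, hQa, hQw]

/-! ### Images of fixed vectors under a spherical matrix -/

/-- All directions have the same upper tail as a coordinate direction. -/
theorem SphericalLaw.normSq_mulVec_gt_le {d n : ℕ} {μ : Measure (Fin d → Fin n → ℝ)}
    [IsProbabilityMeasure μ] (hμ : SphericalLaw μ) {m M B : ℝ} (b : Fin n → ℝ) (j : Fin n) :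
    μ.real {Z | GramBounds m M (of Z) ∧ B * (b ⬝ᵥ b) < (of Z *ᵥ b) ⬝ᵥ (of Z *ᵥ b)} ≤
      μ.real {Z | B < (of Z *ᵥ Pi.single j 1) ⬝ᵥ (of Z *ᵥ Pi.single j 1)} := by
  have hb := dotProduct_self_nonneg_real b
  have h := hμ.measureReal_eq (m := m) (M := M) (p := fun _ y => B * (b ⬝ᵥ b) < y ⬝ᵥ y) (a := 0)
    (w := b) (w' := √(b ⬝ᵥ b) • Pi.single j 1) (by
      apply measurableSet_lt measurable_const
      simp only [dotProduct]
      fun_prop) (by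
      rw [smul_dotProduct, dotProduct_smul]
      simp [Real.mul_self_sqrt hb]) (by simp)
  rw [h]
  refine measureReal_mono (fun Z hZ => ?_) (measure_ne_top _ _)
  have h2 := hZ.2
  rw [mulVec_smul, smul_dotProduct, dotProduct_smul, smul_eq_mul, smul_eq_mul, ← mul_assoc,
    Real.mul_self_sqrt hb, mul_comm] at h2
  exact lt_of_mul_lt_mul_left h2 hb

/-- Lower tail of `|Z a|²` for a unit vector `a`: replace `a` by the random direction `g / |g|`.
With `Z` fixed, `|Z g|²` is rarely below `m d / 4`, while `|g|²` is rarely above `4 n`. -/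
theorem SphericalLaw.normSq_mulVec_le_le {d n : ℕ} {μ : Measure (Fin d → Fin n → ℝ)}
    [IsProbabilityMeasure μ] (hμ : SphericalLaw μ) {m M : ℝ} (hm : 0 < m) (hn : 0 < n)
    {a : Fin n → ℝ} (ha : a ⬝ᵥ a = 1) :
    μ.real {Z | GramBounds m M (of Z) ∧
        (of Z *ᵥ a) ⬝ᵥ (of Z *ᵥ a) ≤ m * d / (16 * n)} ≤
      Real.exp (-(n : ℝ) / 2) + Real.exp (-(d : ℝ) / 4) := by
  have hn' : (0 : ℝ) < n := by exact_mod_cast hn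
  set R : Set ((Fin d → Fin n → ℝ) × (Fin n → ℝ)) :=
    {x | GramBounds m M (of x.1) ∧ x.2 ⬝ᵥ x.2 < 4 * n ∧
      (of x.1 *ᵥ x.2) ⬝ᵥ (of x.1 *ᵥ x.2) ≤ m * d / (16 * n) * (x.2 ⬝ᵥ x.2)} with hRdef
  refine (measureReal_le_of_forall_section (γ := stdGauss n) (R := R)
    (N := {g | 4 * (n : ℝ) ≤ g ⬝ᵥ g}) (δ := Real.exp (-(d : ℝ) / 4)) ?_ ?_ ?_ ?_).trans
    (add_le_add (stdGauss_normSq_ge n) le_rfl)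
  · simp only [hRdef, Set.ofPred_and]
    refine (measurable_fst (isClosed_gramBounds m M).measurableSet).inter
      (MeasurableSet.inter ?_ ?_)
    · refine measurableSet_lt (Continuous.measurable ?_) measurable_const
      simp only [dotProduct]
      fun_prop
    · refine measurableSet_le (Continuous.measurable ?_) (Continuous.measurable ?_)
      · simp only [dotProduct, mulVec, of_apply]
        fun_prop
      · simp only [dotProduct]
        fun_prop
  · refine measurableSet_le measurable_const (Continuous.measurable ?_)
    simp only [dotProduct]
    fun_prop
  · intro g hg
    have hg' : g ⬝ᵥ g < 4 * n := not_le.mp hg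
    have hg0 := dotProduct_self_nonneg_real g
    -- comparing `g` with `|g| a` avoids dividing by `|g|`, so `g = 0` needs no exception
    have h := hμ.measureReal_eq (m := m) (M := M)
      (p := fun _ y => y ⬝ᵥ y ≤ m * d / (16 * n) * (g ⬝ᵥ g)) (a := 0)
      (w := √(g ⬝ᵥ g) • a) (w' := g) (by
        refine measurableSet_le (Continuous.measurable ?_) measurable_const
        simp only [dotProduct]
        fun_prop) (by
        rw [smul_dotProduct, dotProduct_smul]
        simp [Real.mul_self_sqrt hg0, ha]) (by simp)
    refine (measureReal_mono (fun Z hZ => ?_) (measure_ne_top _ _)).trans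
      (h.le.trans (measureReal_mono (fun Z hZ => ⟨hZ.1, hg', hZ.2⟩) (measure_ne_top _ _)))
    refine ⟨hZ.1, ?_⟩
    rw [mulVec_smul, smul_dotProduct, dotProduct_smul, smul_eq_mul, smul_eq_mul, ← mul_assoc,
      Real.mul_self_sqrt hg0, mul_comm]
    exact mul_le_mul_of_nonneg_right hZ.2 hg0
  · intro Z
    by_cases hZ : GramBounds m M (of Z)
    · refine (measureReal_mono (fun g hg => ?_) (measure_ne_top _ _)).trans
        (stdGauss_mulVec_normSq_le hm fun x => (hZ x).1)
      obtain ⟨-, h1, h2⟩ := hg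
      refine h2.trans ?_
      calc m * d / (16 * n) * (g ⬝ᵥ g) ≤ m * d / (16 * n) * (4 * n) := by gcongr
        _ = m * d / 4 := by field_simp; ring
    · have : {y | (Z, y) ∈ R} = ∅ := by
        ext y
        simp [hRdef, hZ]
      rw [this]
      simp only [measureReal_empty]
      positivity

/-- Near orthogonality of `Z a` and `Z w` for `w` orthogonal to the unit vector `a`: replace `w`
by a multiple of `g - ⟨a, g⟩ a`. With `Z` fixed, `⟨Z a, Z (g - ⟨a, g⟩ a)⟩` is a centred Gaussian of
variance at most `|Zᵀ Z a|² ≤ M B`, and `|g - ⟨a, g⟩ a|²` is rarely below `n / 8`. -/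
theorem SphericalLaw.abs_inner_mulVec_ge_le {d n : ℕ} {μ : Measure (Fin d → Fin n → ℝ)}
    [IsProbabilityMeasure μ] (hμ : SphericalLaw μ) {m M B v t : ℝ} (hM : 0 < M) (hB : 0 < B)
    (hv : 0 < v) (ht : 0 < t) (hn : 0 < n) {a w : Fin n → ℝ} (ha : a ⬝ᵥ a = 1)
    (haw : a ⬝ᵥ w = 0) (hw : w ⬝ᵥ w ≤ v) :
    μ.real {Z | GramBounds m M (of Z) ∧ (of Z *ᵥ a) ⬝ᵥ (of Z *ᵥ a) ≤ B ∧
        t ≤ |(of Z *ᵥ a) ⬝ᵥ (of Z *ᵥ w)|} ≤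
      Real.exp (-(n : ℝ) / 4) + 2 * Real.exp (-(n : ℝ) / 16) +
        2 * Real.exp (-t ^ 2 * n / (16 * v * M * B)) := by
  have hn' : (0 : ℝ) < n := by exact_mod_cast hn
  set R : Set ((Fin d → Fin n → ℝ) × (Fin n → ℝ)) :=
    {x | GramBounds m M (of x.1) ∧ (of x.1 *ᵥ a) ⬝ᵥ (of x.1 *ᵥ a) ≤ B ∧
      √(n / 8) * t ≤ √v * |(of x.1 *ᵥ a) ⬝ᵥ (of x.1 *ᵥ (x.2 - (a ⬝ᵥ x.2) • a))|} with hRdef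
  have hNle : (stdGauss n).real ({g | g ⬝ᵥ g ≤ (n : ℝ) / 4} ∪ {g | √(n / 8) ≤ |a ⬝ᵥ g|}) ≤
      Real.exp (-(n : ℝ) / 4) + 2 * Real.exp (-(n : ℝ) / 16) := by
    refine (measureReal_union_le _ _).trans (add_le_add (stdGauss_normSq_le n) ?_)
    refine (stdGauss_abs_linear_ge one_pos ha.le (Real.sqrt_nonneg _)).trans_eq ?_
    rw [neg_eq_neg_one_mul, Real.sq_sqrt (by positivity)]
    congr 2; ring
  refine (measureReal_le_of_forall_section (γ := stdGauss n) (R := R)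
    (N := {g | g ⬝ᵥ g ≤ (n : ℝ) / 4} ∪ {g | √(n / 8) ≤ |a ⬝ᵥ g|})
    (δ := 2 * Real.exp (-t ^ 2 * n / (16 * v * M * B))) ?_ ?_ ?_ ?_).trans
    (add_le_add hNle le_rfl)
  · simp only [hRdef, Set.ofPred_and]
    refine (measurable_fst (isClosed_gramBounds m M).measurableSet).inter
      (MeasurableSet.inter ?_ ?_)
    · refine measurableSet_le (Continuous.measurable ?_) measurable_const
      simp only [dotProduct, mulVec, of_apply]
      fun_prop
    · refine measurableSet_le measurable_const (Continuous.measurable ?_)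
      simp only [dotProduct, mulVec, of_apply, Pi.sub_apply, Pi.smul_apply, smul_eq_mul]
      fun_prop
  · refine MeasurableSet.union ?_ ?_
    · refine measurableSet_le (Continuous.measurable ?_) measurable_const
      simp only [dotProduct]
      fun_prop
    · refine measurableSet_le measurable_const (Continuous.measurable ?_)
      simp only [dotProduct]
      fun_prop
  · intro g hg
    rw [Set.mem_union, not_or] at hg
    have hg1 : (n : ℝ) / 4 < g ⬝ᵥ g := not_le.mp hg.1
    have hg2 : |a ⬝ᵥ g| < √(n / 8) := not_le.mp hg.2
    have hg3 : (a ⬝ᵥ g) ^ 2 < n / 8 := by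
      rw [← sq_abs]
      exact (Real.lt_sqrt (abs_nonneg _)).mp hg2
    set g' := g - (a ⬝ᵥ g) • a with hg'
    have hag' : a ⬝ᵥ g' = 0 := dotProduct_sub_proj ha g
    have hgg : g' ⬝ᵥ g' = g ⬝ᵥ g - (a ⬝ᵥ g) ^ 2 := normSq_sub_proj ha g
    have hg'pos : n / 8 ≤ g' ⬝ᵥ g' := by linarith
    have hs : 0 < √(g' ⬝ᵥ g') := Real.sqrt_pos.mpr (lt_of_lt_of_le (by positivity) hg'pos)
    have hw0 := dotProduct_self_nonneg_real w
    have h := hμ.measureReal_eq (m := m) (M := M)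
      (p := fun x y => x ⬝ᵥ x ≤ B ∧ t ≤ |x ⬝ᵥ y|) (a := a)
      (w := w) (w' := (√(w ⬝ᵥ w) / √(g' ⬝ᵥ g')) • g') (by
        rw [Set.ofPred_and]
        refine MeasurableSet.inter ?_ ?_
        · refine measurableSet_le (Continuous.measurable ?_) measurable_const
          simp only [dotProduct]
          fun_prop
        · refine measurableSet_le measurable_const (Continuous.measurable ?_)
          simp only [dotProduct]
          fun_prop) (by
        rw [smul_dotProduct, dotProduct_smul, smul_eq_mul, smul_eq_mul]
        have h1 := Real.mul_self_sqrt hw0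
        have h2 := Real.mul_self_sqrt (dotProduct_self_nonneg_real g')
        rw [← mul_assoc, div_mul_div_comm, h1, h2, div_mul_cancel₀]
        exact (lt_of_lt_of_le (by positivity) hg'pos).ne')
      (by rw [haw, dotProduct_smul, hag', smul_zero])
    rw [h]
    refine measureReal_mono (fun Z hZ => ?_) (measure_ne_top _ _)
    obtain ⟨h1, h2, h3⟩ := hZ
    refine ⟨h1, h2, ?_⟩
    rw [mulVec_smul, dotProduct_smul, smul_eq_mul, abs_mul, abs_of_nonneg (by positivity),
      div_mul_eq_mul_div, le_div_iff₀ hs] at h3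
    calc √(n / 8) * t ≤ √(g' ⬝ᵥ g') * t := by gcongr
      _ = t * √(g' ⬝ᵥ g') := mul_comm _ _
      _ ≤ _ := h3
      _ ≤ _ := by gcongr
  · intro Z
    by_cases hZ : GramBounds m M (of Z) ∧ (of Z *ᵥ a) ⬝ᵥ (of Z *ᵥ a) ≤ B
    · set y := (of Z)ᵀ *ᵥ (of Z *ᵥ a) with hy
      have hinner : ∀ g : Fin n → ℝ, (of Z *ᵥ a) ⬝ᵥ (of Z *ᵥ (g - (a ⬝ᵥ g) • a)) =
          (y - (a ⬝ᵥ y) • a) ⬝ᵥ g := by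
        intro g
        rw [dotProduct_comm, mulVec_dotProduct_comm, ← hy]
        have h3 := dotProduct_comm g y
        simp only [sub_dotProduct, smul_dotProduct, smul_eq_mul, h3]
        ring
      have hy1 : (y - (a ⬝ᵥ y) • a) ⬝ᵥ (y - (a ⬝ᵥ y) • a) ≤ M * B :=
        (normSq_sub_proj_le ha y).trans
          (((hZ.1 _).2).trans (mul_le_mul_of_nonneg_left hZ.2 hM.le))
      refine (measureReal_mono (fun g hg => ?_) (measure_ne_top _ _)).trans
        ((stdGauss_abs_linear_ge (mul_pos hM hB) hy1
          (t := √(n / 8) * t / √v) (by positivity)).trans_eq ?_)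
      · have h6 := hg.2.2
        rw [hinner] at h6
        exact (div_le_iff₀' (by positivity)).mpr h6
      · rw [neg_eq_neg_one_mul, div_pow, mul_pow, Real.sq_sqrt (by positivity),
          Real.sq_sqrt hv.le]
        congr 2
        field_simp
        ring
    · have : {y | (Z, y) ∈ R} = ∅ := by
        ext y
        simp only [hRdef, Set.mem_ofPred_eq, Set.mem_empty_iff_false, iff_false]
        exact fun h => hZ ⟨h.1, h.2.1⟩
      rw [this]
      simp only [measureReal_empty]
      positivity

/-! ### Counting, top sets and the whitened matrix -/

theorem countAboveMin_eq_card {n : ℕ} (f : Fin n → ℝ) (M : Finset (Fin n)) (hM : M.Nonempty) :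
    countAboveMin f M hM = (({i | M.inf' hM f ≤ f i} : Finset (Fin n)).card : ℝ) := by
  simp [countAboveMin]

/-- Each counted index contributes at least `m ^ 2` to the sum of squares. -/
theorem countAboveMin_le_of_sum_sq_le {n : ℕ} {f : Fin n → ℝ} {M : Finset (Fin n)}
    (hM : M.Nonempty) {m b : ℝ} (hm : 0 < m) (hf : ∀ i ∈ M, m ≤ f i) (hb : f ⬝ᵥ f ≤ b) :
    countAboveMin f M hM ≤ b / m ^ 2 := by
  rw [le_div_iff₀ (by positivity)]
  refine le_trans ?_ hb
  rw [countAboveMin, Finset.sum_mul, dotProduct]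
  refine Finset.sum_le_sum fun i _ => ?_
  split_ifs with h
  · have : m ≤ f i := ((Finset.le_inf'_iff hM f).mpr hf).trans h
    nlinarith
  · nlinarith [mul_self_nonneg (f i)]

/-- If `j ∈ M` were missing from `T`, then `j` and all of `T` would be counted: too many indices. -/
theorem IsTopK.subset_of_countAboveMin_le {n k : ℕ} {f : Fin n → ℝ} {M T : Finset (Fin n)}
    (hM : M.Nonempty) (hc : countAboveMin f M hM ≤ k) (hT : IsTopK f k T) : M ⊆ T := by
  intro j hj
  by_contra hjT
  rw [countAboveMin_eq_card] at hc
  have hc' : ({i | M.inf' hM f ≤ f i} : Finset (Fin n)).card ≤ k := by exact_mod_cast hc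
  have hjm : M.inf' hM f ≤ f j := Finset.inf'_le f hj
  have hsub : insert j T ⊆ ({i | M.inf' hM f ≤ f i} : Finset (Fin n)) := by
    intro i hi
    rw [Finset.mem_filter]
    rcases Finset.mem_insert.mp hi with rfl | hi
    · exact ⟨Finset.mem_univ _, hjm⟩
    · exact ⟨Finset.mem_univ _, hjm.trans (hT.2 i hi j hjT)⟩
  have h1 := Finset.card_le_card hsub
  have h2 := Finset.card_le_univ ({i | M.inf' hM f ≤ f i} : Finset (Fin n))
  rw [Finset.card_insert_of_notMem hjT, hT.1] at h1
  rw [Fintype.card_fin] at h2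
  omega

section Whitening

variable {n d : ℕ} {S : Matrix (Fin n) (Fin n) ℝ}

theorem transpose_cfc_sqrt (S : Matrix (Fin n) (Fin n) ℝ) : (CFC.sqrt S)ᵀ = CFC.sqrt S := by
  have h := (CFC.sqrt_nonneg S).isSelfAdjoint
  rwa [isSelfAdjoint_iff, star_eq_conjTranspose, conjTranspose_eq_transpose_of_trivial] at h

theorem sqrt_mul_sqrt_of_posDef (hS : S.PosDef) : CFC.sqrt S * CFC.sqrt S = S :=
  CFC.sqrt_mul_sqrt_self S hS.posSemidef.nonneg

theorem whiten_mul_sqrt (hS : S.PosDef) (K : Matrix (Fin n) (Fin d) ℝ) :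
    whiten S K * CFC.sqrt S = Kᵀ := by
  have hdet : IsUnit (CFC.sqrt S).det := by
    have h := congrArg Matrix.det (sqrt_mul_sqrt_of_posDef hS)
    rw [det_mul] at h
    rw [isUnit_iff_ne_zero]
    intro h0
    rw [h0, mul_zero] at h
    exact hS.det_pos.ne h
  rw [whiten, Matrix.mul_assoc, Matrix.nonsing_inv_mul _ hdet, Matrix.mul_one]

theorem sqrt_mulVec_dotProduct (hS : S.PosDef) (x y : Fin n → ℝ) :
    (CFC.sqrt S *ᵥ x) ⬝ᵥ (CFC.sqrt S *ᵥ y) = x ⬝ᵥ S *ᵥ y := by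
  rw [mulVec_dotProduct_comm, transpose_cfc_sqrt, mulVec_mulVec, sqrt_mul_sqrt_of_posDef hS]

theorem whiten_mulVec_sqrt_mulVec (hS : S.PosDef) (K : Matrix (Fin n) (Fin d) ℝ)
    (x : Fin n → ℝ) : whiten S K *ᵥ (CFC.sqrt S *ᵥ x) = x ᵥ* K := by
  rw [mulVec_mulVec, whiten_mul_sqrt hS, mulVec_transpose]

/-- The `i`-th column of `S^{1/2}`: the vector `a` with `kᵢ = Z a`, where `Z` is the whitened
matrix. -/
noncomputable def whitenedKey (S : Matrix (Fin n) (Fin n) ℝ) (i : Fin n) : Fin n → ℝ :=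
  CFC.sqrt S *ᵥ Pi.single i 1

theorem score_eq_dotProduct_whiten (hS : S.PosDef) (K : Matrix (Fin n) (Fin d) ℝ) (q : Fin d → ℝ)
    (i : Fin n) : score K q i = q ⬝ᵥ (whiten S K *ᵥ whitenedKey S i) := by
  rw [whitenedKey, whiten_mulVec_sqrt_mulVec hS, single_one_vecMul]
  rfl

/-- The scores form the vector `S^{1/2} Zᵀ q`, so two operator norm bounds control their squares. -/
theorem score_normSq_le (hS : S.PosDef) (K : Matrix (Fin n) (Fin d) ℝ) (q : Fin d → ℝ)
    {m M : ℝ} (hZ : GramBounds m M (whiten S K)) {l : ℝ} (hl : lamMax S ≤ l)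
    (hl0 : 0 ≤ l) :
    score K q ⬝ᵥ score K q ≤ l * (M * (q ⬝ᵥ q)) := by
  have h : score K q = CFC.sqrt S *ᵥ ((whiten S K)ᵀ *ᵥ q) := by
    have h2 := congrArg Matrix.transpose (whiten_mul_sqrt hS K)
    rw [transpose_mul, transpose_cfc_sqrt, transpose_transpose] at h2
    rw [mulVec_mulVec, h2]
    ext i
    exact dotProduct_comm _ _
  rw [h, sqrt_mulVec_dotProduct hS]
  calc _ ≤ _ := dotProduct_mulVec_le_lamMax hS.isHermitian _
    _ ≤ l * (((whiten S K)ᵀ *ᵥ q) ⬝ᵥ ((whiten S K)ᵀ *ᵥ q)) :=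
        mul_le_mul_of_nonneg_right hl (dotProduct_self_nonneg_real _)
    _ ≤ _ := mul_le_mul_of_nonneg_left (hZ q).2 hl0

end Whitening

section Gram

variable {n d : ℕ}

theorem subGram_isHermitian (Z : Matrix (Fin d) (Fin n) ℝ) (J : Finset (Fin n)) :
    (subGram Z J).IsHermitian := by
  unfold subGram
  rw [IsHermitian, conjTranspose_eq_transpose_of_trivial, transpose_smul, transpose_mul,
    transpose_transpose]

theorem dotProduct_subGram_mulVec (Z : Matrix (Fin d) (Fin n) ℝ) (J : Finset (Fin n))
    (x : Fin d → ℝ) : x ⬝ᵥ subGram Z J *ᵥ x = (J.card : ℝ)⁻¹ * ∑ i ∈ J, ((Zᵀ *ᵥ x) i) ^ 2 := by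
  rw [subGram, smul_mulVec, dotProduct_smul, dotProduct_mul_transpose_mulVec, smul_eq_mul]
  congr 1
  rw [dotProduct, ← Finset.sum_coe_sort J]
  refine Finset.sum_congr rfl fun i _ => ?_
  rw [sq]
  rfl

theorem gramBounds_of_subGram {Z : Matrix (Fin d) (Fin n) ℝ} {c : ℝ} (hn : 0 < n)
    (h1 : lamMax (subGram Z Finset.univ) ≤ c) (h2 : 1 / c ≤ lamMin (subGram Z Finset.univ)) :
    GramBounds (n / c) (c * n) Z := by
  intro x
  have hn' : (0 : ℝ) < n := by exact_mod_cast hn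
  have hx := dotProduct_self_nonneg_real x
  have h : (Zᵀ *ᵥ x) ⬝ᵥ (Zᵀ *ᵥ x) = n * (x ⬝ᵥ subGram Z Finset.univ *ᵥ x) := by
    rw [dotProduct_subGram_mulVec, Finset.card_univ, Fintype.card_fin, ← mul_assoc,
      mul_inv_cancel₀ hn'.ne', one_mul, dotProduct]
    simp only [sq]
  rw [h]
  have h3 := dotProduct_mulVec_le_lamMax (subGram_isHermitian Z Finset.univ) x
  have h4 := lamMin_le_dotProduct_mulVec (subGram_isHermitian Z Finset.univ) x
  constructor
  · calc n / c * (x ⬝ᵥ x) = n * (1 / c * (x ⬝ᵥ x)) := by ring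
      _ ≤ n * (lamMin (subGram Z Finset.univ) * (x ⬝ᵥ x)) := by gcongr
      _ ≤ _ := by gcongr
  · calc _ ≤ n * (lamMax (subGram Z Finset.univ) * (x ⬝ᵥ x)) := by gcongr
      _ ≤ n * (c * (x ⬝ᵥ x)) := by gcongr
      _ = _ := by ring

/-- A column `y` of the submatrix satisfies `|y|⁴ ≤ |Z_Jᵀ y|² ≤ c #J |y|²`. -/
theorem normSq_col_le_of_subGram {Z : Matrix (Fin d) (Fin n) ℝ} {J : Finset (Fin n)} {c : ℝ}
    (h : lamMax (subGram Z J) ≤ c) (hc : 0 ≤ c) {j : Fin n} (hj : j ∈ J) :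
    (Z *ᵥ Pi.single j 1) ⬝ᵥ (Z *ᵥ Pi.single j 1) ≤ c * J.card := by
  set y := Z *ᵥ Pi.single j 1 with hy
  have hJ : (0 : ℝ) < J.card := by exact_mod_cast Finset.card_pos.mpr ⟨j, hj⟩
  have hyy : y ⬝ᵥ y = (Zᵀ *ᵥ y) j := by
    nth_rw 1 [hy]
    rw [mulVec_dotProduct_comm, single_one_dotProduct]
  have hy0 := dotProduct_self_nonneg_real y
  have h1 := (dotProduct_mulVec_le_lamMax (subGram_isHermitian Z J) y).trans
    (mul_le_mul_of_nonneg_right h hy0)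
  rw [dotProduct_subGram_mulVec, inv_mul_le_iff₀ hJ] at h1
  have h2 : (y ⬝ᵥ y) ^ 2 ≤ J.card * (c * (y ⬝ᵥ y)) := by
    rw [hyy] at h1 ⊢
    exact (Finset.single_le_sum (f := fun i => ((Zᵀ *ᵥ y) i) ^ 2) (fun i _ => sq_nonneg _) hj).trans
      h1
  by_contra hlt
  rw [not_le] at hlt
  have : 0 < y ⬝ᵥ y := lt_of_le_of_lt (by positivity) hlt
  nlinarith

end Gram

/-! ### Moments and independence in the model -/

theorem measurable_entries_whiten {n d : ℕ} (S : Matrix (Fin n) (Fin n) ℝ) :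
    Measurable fun A : Fin n → Fin d → ℝ => entries (whiten S (of A)) := by
  apply Continuous.measurable
  unfold entries whiten
  simp only [Matrix.mul_apply, transpose_apply, of_apply]
  fun_prop

theorem StandardizedKeys.measurable_whiten {Ω : Type*} [MeasurableSpace Ω] {P : Measure Ω} {n d : ℕ}
    {K : Ω → Matrix (Fin n) (Fin d) ℝ} {S : Matrix (Fin n) (Fin n) ℝ}
    (hK : StandardizedKeys P K S) : Measurable fun ω => entries (whiten S (K ω)) :=
  (measurable_entries_whiten S).comp hK.meas

section Model

variable {Ω : Type*} [MeasurableSpace Ω] {P : Measure Ω} {n d : ℕ}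
  {K : Ω → Matrix (Fin n) (Fin d) ℝ} {ε : Ω → Fin d → ℝ} {β : Fin n → ℝ} {σ : ℝ≥0}
  {S : Matrix (Fin n) (Fin n) ℝ}

theorem StandardizedKeys.sphericalLaw (hK : StandardizedKeys P K S) :
    SphericalLaw (P.map fun ω => entries (whiten S (K ω))) := by
  intro Q hQ
  rw [Measure.map_map (measurable_entries_mul Q) hK.measurable_whiten]
  exact (hK.spherical Q hQ).map_eq

theorem GaussianNoise.map_inv_smul [IsProbabilityMeasure P] (hε : GaussianNoise P K ε σ) :
    P.map (fun ω => (σ : ℝ)⁻¹ • ε ω) = stdGauss d := by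
  have hm : ∀ t, Measurable fun ω => ε ω t := fun t => (measurable_pi_apply t).comp hε.meas
  have h : iIndepFun (fun t ω => (σ : ℝ)⁻¹ * ε ω t) P :=
    hε.indep.comp (fun _ x => (σ : ℝ)⁻¹ * x) (fun _ => by fun_prop)
  rw [iIndepFun_iff_map_fun_eq_pi_map (fun t => ((hm t).const_mul _).aemeasurable)] at h
  have hlaw : ∀ t, P.map (fun ω => (σ : ℝ)⁻¹ * ε ω t) = gaussianReal 0 1 := by
    intro t
    have h2 := gaussianReal_map_const_mul (μ := 0) (v := σ ^ 2) (σ : ℝ)⁻¹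
    rw [← hε.law t, Measure.map_map (by fun_prop) (hm t)] at h2
    refine h2.trans ?_
    have h4 : (σ : ℝ) ≠ 0 := by exact_mod_cast hε.sigma_pos.ne'
    congr 1
    · simp
    · ext
      simp
      field_simp
  simp_rw [hlaw] at h
  exact h

theorem GaussianNoise.map_prod [IsProbabilityMeasure P] (hε : GaussianNoise P K ε σ)
    (hK : StandardizedKeys P K S) :
    P.map (fun ω => (entries (whiten S (K ω)), (σ : ℝ)⁻¹ • ε ω)) =
      (P.map fun ω => entries (whiten S (K ω))).prod (stdGauss d) := by
  have hi : IndepFun (fun ω => entries (whiten S (K ω))) (fun ω => (σ : ℝ)⁻¹ • ε ω) P :=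
    hε.indep_keys.comp (measurable_entries_whiten S) (measurable_const_smul (σ : ℝ)⁻¹)
  have hm : Measurable fun ω => (σ : ℝ)⁻¹ • ε ω := measurable_const_smul (σ : ℝ)⁻¹ |>.comp hε.meas
  rw [(indepFun_iff_map_prod_eq_prod_map_map hK.measurable_whiten.aemeasurable
    hm.aemeasurable).mp hi, hε.map_inv_smul]

theorem GaussianNoise.memLp (hε : GaussianNoise P K ε σ) (t : Fin d) :
    MemLp (fun ω => ε ω t) 2 P := by
  have hm : Measurable fun ω => ε ω t := (measurable_pi_apply t).comp hε.meas
  have h : MemLp id 2 (P.map fun ω => ε ω t) := by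
    rw [hε.law]
    exact_mod_cast memLp_id_gaussianReal 2
  exact (memLp_map_measure_iff (by fun_prop) hm.aemeasurable).mp h

theorem GaussianNoise.variance_eq (hε : GaussianNoise P K ε σ) (t : Fin d) :
    Var[fun ω => ε ω t; P] = (σ : ℝ) ^ 2 := by
  have hm : Measurable fun ω => ε ω t := (measurable_pi_apply t).comp hε.meas
  rw [← variance_id_map hm.aemeasurable, hε.law, variance_id_gaussianReal]
  simp

theorem GaussianNoise.indepFun_key (hε : GaussianNoise P K ε σ) (i : Fin n) (t : Fin d) :
    IndepFun (fun ω => K ω i t) (fun ω => ε ω t) P :=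
  hε.indep_keys.comp (φ := fun A : Fin n → Fin d → ℝ => A i t)
    (ψ := fun e : Fin d → ℝ => e t) (by fun_prop) (by fun_prop)

theorem covariance_query_key [IsProbabilityMeasure P] (hε : GaussianNoise P K ε σ)
    (hK : StandardizedKeys P K S) (i : Fin n) (t : Fin d) :
    cov[fun ω => query β (K ω) (ε ω) t, fun ω => K ω i t; P] = (S *ᵥ β) i := by
  have hβK : ∀ j, MemLp (fun ω => β j * K ω j t) 2 P := fun j => (hK.memLp j t).const_mul _
  have h := covariance_add_left (memLp_finsetSum Finset.univ fun j _ => hβK j) (hε.memLp t)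
    (hK.memLp i t)
  have h0 : cov[fun ω => ε ω t, fun ω => K ω i t; P] = 0 :=
    (hε.indepFun_key i t).symm.covariance_eq_zero (hε.memLp t) (hK.memLp i t)
  rw [h0, add_zero, covariance_fun_sum_left hβK (hK.memLp i t)] at h
  calc _ = _ := h
    _ = _ := by
      simp_rw [covariance_const_mul_left, hK.cov_eq, mulVec, dotProduct]
      refine Finset.sum_congr rfl fun j _ => ?_
      rw [mul_comm, ← hK.posDef.isHermitian.apply i j]
      simp

theorem variance_query [IsProbabilityMeasure P] (hε : GaussianNoise P K ε σ)
    (hK : StandardizedKeys P K S) (t : Fin d) :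
    Var[fun ω => query β (K ω) (ε ω) t; P] = β ⬝ᵥ S *ᵥ β + (σ : ℝ) ^ 2 := by
  have hβK : ∀ j, MemLp (fun ω => β j * K ω j t) 2 P := fun j => (hK.memLp j t).const_mul _
  have hsum : MemLp (fun ω => ∑ j, β j * K ω j t) 2 P := memLp_finsetSum _ fun j _ => hβK j
  have hi : IndepFun (fun ω => ∑ j, β j * K ω j t) (fun ω => ε ω t) P :=
    hε.indep_keys.comp (φ := fun A : Fin n → Fin d → ℝ => ∑ j, β j * A j t)
      (ψ := fun e : Fin d → ℝ => e t) (by fun_prop)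
      (by fun_prop)
  have h := IndepFun.variance_fun_add hsum (hε.memLp t) hi
  rw [hε.variance_eq, ← covariance_self hsum.aestronglyMeasurable.aemeasurable,
    covariance_fun_sum_left hβK hsum] at h
  calc _ = _ := h
    _ = _ := by
      congr 1
      simp_rw [covariance_const_mul_left, covariance_fun_sum_right hβK (hK.memLp _ t),
        covariance_const_mul_right, hK.cov_eq, dotProduct, mulVec, dotProduct]
      refine Finset.sum_congr rfl fun j _ => ?_
      congr 1
      exact Finset.sum_congr rfl fun k _ => mul_comm _ _

theorem StandardizedKeys.whitenedKey_normSq (hK : StandardizedKeys P K S) (i : Fin n) :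
    whitenedKey S i ⬝ᵥ whitenedKey S i = 1 := by
  rw [whitenedKey, sqrt_mulVec_dotProduct hK.posDef, mulVec_single_one, single_one_dotProduct]
  exact hK.unit_var i

/-- The variance of a coordinate of the query is `|S^{1/2} β|² + σ²`. -/
theorem normSq_add_noise_le [IsProbabilityMeasure P] (hε : GaussianNoise P K ε σ)
    (hK : StandardizedKeys P K S) {κ v c₅ c₆ : ℝ} (hq : SignalStrength P K ε β κ v c₅ c₆)
    (hd : 0 < d) :
    (CFC.sqrt S *ᵥ β) ⬝ᵥ (CFC.sqrt S *ᵥ β) + (σ : ℝ) ^ 2 ≤ v := by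
  rw [sqrt_mulVec_dotProduct hK.posDef, ← variance_query hε hK ⟨0, hd⟩]
  exact hq.var_query ⟨0, hd⟩

/-- The covariance of the query with a key is the inner product of the whitened key with the
whitened weights, so signal strength bounds that inner product below. -/
theorem le_whitenedKey_dotProduct [IsProbabilityMeasure P] (hε : GaussianNoise P K ε σ)
    (hK : StandardizedKeys P K S) {κ v c₅ c₆ : ℝ} (hq : SignalStrength P K ε β κ v c₅ c₆)
    (hc₆ : 0 ≤ c₆) (hd : 0 < d) {i : Fin n} (hi : i ∈ relevant β) :
    c₅ * c₆ / (d : ℝ) ^ κ ≤ whitenedKey S i ⬝ᵥ (CFC.sqrt S *ᵥ β) := by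
  have h1 := hq.cov_ge i hi ⟨0, hd⟩
  have h2 := hq.weight_ge i hi
  have h3 : 0 < β i := by simpa [relevant] using hi
  rw [covariance_const_mul_left, covariance_query_key hε hK, le_inv_mul_iff₀ h3] at h1
  rw [whitenedKey, sqrt_mulVec_dotProduct hK.posDef, single_one_dotProduct]
  calc c₅ * c₆ / (d : ℝ) ^ κ = c₅ / (d : ℝ) ^ κ * c₆ := by ring
    _ ≤ β i * c₆ := by gcongr
    _ ≤ _ := h1

end Model

/-! ### Tail bounds for the keys and the query -/

section Tails

variable {Ω : Type*} [MeasurableSpace Ω] {P : Measure Ω} {n d : ℕ}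
  {K : Ω → Matrix (Fin n) (Fin d) ℝ} {ε : Ω → Fin d → ℝ} {β : Fin n → ℝ} {σ : ℝ≥0}
  {S : Matrix (Fin n) (Fin n) ℝ}

/-- No measurability of `A` is needed: `Measure.map` can only increase the outer measure of a
preimage. -/
theorem StandardizedKeys.measureReal_whiten_le [IsProbabilityMeasure P]
    (hK : StandardizedKeys P K S) {A : Set (Fin d → Fin n → ℝ)} {δ : ℝ}
    (h : (P.map fun ω => entries (whiten S (K ω))).real A ≤ δ) :
    P.real {ω | entries (whiten S (K ω)) ∈ A} ≤ δ := by
  refine le_trans ?_ h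
  exact ENNReal.toReal_mono (measure_ne_top _ _)
    (Measure.le_map_apply hK.measurable_whiten.aemeasurable A)

theorem GaussianNoise.normSq_gt_le [IsProbabilityMeasure P] (hε : GaussianNoise P K ε σ) {v : ℝ}
    (hv : (σ : ℝ) ^ 2 ≤ v) :
    P.real {ω | 4 * v * d < ε ω ⬝ᵥ ε ω} ≤ Real.exp (-(d : ℝ) / 2) := by
  have hσ : (0 : ℝ) < σ := by exact_mod_cast hε.sigma_pos
  have hm : Measurable fun ω => (σ : ℝ)⁻¹ • ε ω := measurable_const_smul (σ : ℝ)⁻¹ |>.comp hε.meas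
  refine le_trans ?_ (stdGauss_normSq_ge d)
  rw [← hε.map_inv_smul]
  refine le_trans ?_ (ENNReal.toReal_mono (measure_ne_top _ _)
    (Measure.le_map_apply hm.aemeasurable _))
  refine measureReal_mono (fun ω hω => ?_) (measure_ne_top _ _)
  have h1 : 4 * v * d < ε ω ⬝ᵥ ε ω := hω
  change 4 * (d : ℝ) ≤ ((σ : ℝ)⁻¹ • ε ω) ⬝ᵥ ((σ : ℝ)⁻¹ • ε ω)
  rw [smul_dotProduct, dotProduct_smul, smul_eq_mul, smul_eq_mul, ← mul_assoc, ← mul_inv,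
    le_inv_mul_iff₀ (by positivity)]
  refine le_trans ?_ h1.le
  calc (σ : ℝ) * σ * (4 * d) = 4 * (σ : ℝ) ^ 2 * d := by ring
    _ ≤ _ := by gcongr

/-- Given the keys, `⟨Z a, ε⟩` is a centred Gaussian of variance `σ² |Z a|² ≤ v B`. -/
theorem GaussianNoise.abs_inner_ge_le [IsProbabilityMeasure P] (hε : GaussianNoise P K ε σ)
    (hK : StandardizedKeys P K S) {v B t : ℝ} (hv : (σ : ℝ) ^ 2 ≤ v) (hB : 0 < B) (ht : 0 < t)
    (a : Fin n → ℝ) :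
    P.real {ω | (whiten S (K ω) *ᵥ a) ⬝ᵥ (whiten S (K ω) *ᵥ a) ≤ B ∧
        t ≤ |(whiten S (K ω) *ᵥ a) ⬝ᵥ ε ω|} ≤ 2 * Real.exp (-t ^ 2 / (2 * v * B)) := by
  have hσ : (0 : ℝ) < σ := by exact_mod_cast hε.sigma_pos
  have hm : Measurable fun ω => (entries (whiten S (K ω)), (σ : ℝ)⁻¹ • ε ω) :=
    hK.measurable_whiten.prodMk (measurable_const_smul (σ : ℝ)⁻¹ |>.comp hε.meas)
  have : IsProbabilityMeasure (P.map fun ω => entries (whiten S (K ω))) :=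
    Measure.isProbabilityMeasure_map hK.measurable_whiten.aemeasurable
  set R : Set ((Fin d → Fin n → ℝ) × (Fin d → ℝ)) :=
    {x | (of x.1 *ᵥ a) ⬝ᵥ (of x.1 *ᵥ a) ≤ B ∧ t ≤ σ * |(of x.1 *ᵥ a) ⬝ᵥ x.2|} with hRdef
  have hR : MeasurableSet R := by
    simp only [hRdef, Set.ofPred_and]
    refine MeasurableSet.inter ?_ ?_
    · refine measurableSet_le (Continuous.measurable ?_) measurable_const
      simp only [dotProduct, mulVec, of_apply]
      fun_prop
    · refine measurableSet_le measurable_const (Continuous.measurable ?_)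
      simp only [dotProduct, mulVec, of_apply]
      fun_prop
  have h := prod_measureReal_le_of_forall_section (γ := stdGauss d)
    (μ := P.map fun ω => entries (whiten S (K ω))) (R := R)
    (δ := 2 * Real.exp (-t ^ 2 / (2 * v * B))) hR ?_
  · rw [← hε.map_prod hK, map_measureReal_apply hm hR] at h
    refine le_trans (measureReal_mono (fun ω hω => ?_) (measure_ne_top _ _)) h
    refine ⟨hω.1, hω.2.trans_eq ?_⟩
    change _ = (σ : ℝ) * |(whiten S (K ω) *ᵥ a) ⬝ᵥ ((σ : ℝ)⁻¹ • ε ω)|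
    rw [dotProduct_smul, smul_eq_mul, abs_mul, abs_of_pos (inv_pos.mpr hσ), ← mul_assoc,
      mul_inv_cancel₀ hσ.ne', one_mul]
  · intro Z
    by_cases hZ : (of Z *ᵥ a) ⬝ᵥ (of Z *ᵥ a) ≤ B
    · refine (measureReal_mono (fun g hg => ?_) (measure_ne_top _ _)).trans
        ((stdGauss_abs_linear_ge hB hZ (t := t / σ) (by positivity)).trans ?_)
      · exact (div_le_iff₀' hσ).mpr hg.2
      · have h1 : t ^ 2 / (2 * v * B) ≤ (t / σ) ^ 2 / (2 * B) := by
          rw [div_pow, div_div]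
          gcongr t ^ 2 / ?_
          nlinarith
        rw [neg_div, neg_div]
        gcongr
    · have : {y | (Z, y) ∈ R} = ∅ := by
        ext y
        simp [hRdef, hZ]
      rw [this]
      simp only [measureReal_empty]
      positivity

theorem StandardizedKeys.normSq_whiten_mulVec_gt_le [IsProbabilityMeasure P]
    (hK : StandardizedKeys P K S) {m M B δ : ℝ} (b : Fin n → ℝ) {j : Fin n}
    (hδ : P.real {ω | B < (whiten S (K ω) *ᵥ Pi.single j 1) ⬝ᵥ
      (whiten S (K ω) *ᵥ Pi.single j 1)} ≤ δ) :
    P.real {ω | GramBounds m M (whiten S (K ω)) ∧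
      B * (b ⬝ᵥ b) < (whiten S (K ω) *ᵥ b) ⬝ᵥ (whiten S (K ω) *ᵥ b)} ≤ δ := by
  have : IsProbabilityMeasure (P.map fun ω => entries (whiten S (K ω))) :=
    Measure.isProbabilityMeasure_map hK.measurable_whiten.aemeasurable
  exact (hK.measureReal_whiten_le ((hK.sphericalLaw.normSq_mulVec_gt_le (m := m)
    (M := M) (B := B) b j).trans_eq (map_measureReal_apply hK.measurable_whiten (by
      refine measurableSet_lt measurable_const (Continuous.measurable ?_)
      simp only [dotProduct, mulVec, of_apply]
      fun_prop)))).trans hδ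

/-- For a unit vector `a`, outside an event of small probability `|Z a|²` is of order `d` while both
`⟨Z a, Z w⟩` and `⟨Z a, ε⟩` are below `t`. The upper bound `B` on `|Z a|²`, whose failure is
controlled by the column `j`, limits the variances of the two cross terms. -/
theorem StandardizedKeys.direction_tail [IsProbabilityMeasure P] (hε : GaussianNoise P K ε σ)
    (hK : StandardizedKeys P K S) {c₄ v B t δ : ℝ} (hc₄ : 0 < c₄) (hv : (σ : ℝ) ^ 2 ≤ v)
    (hB : 0 < B) (ht : 0 < t) (hn : 0 < n) {j : Fin n}
    (hδ : P.real {ω | B < (whiten S (K ω) *ᵥ Pi.single j 1) ⬝ᵥ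
      (whiten S (K ω) *ᵥ Pi.single j 1)} ≤ δ)
    {a w : Fin n → ℝ} (ha : a ⬝ᵥ a = 1) (haw : a ⬝ᵥ w = 0) (hw : w ⬝ᵥ w ≤ v) :
    P.real {ω | GramBounds (n / c₄) (c₄ * n) (whiten S (K ω)) ∧
        ((whiten S (K ω) *ᵥ a) ⬝ᵥ (whiten S (K ω) *ᵥ a) ≤ d / (16 * c₄) ∨
          t ≤ |(whiten S (K ω) *ᵥ a) ⬝ᵥ (whiten S (K ω) *ᵥ w)| ∨
          t ≤ |(whiten S (K ω) *ᵥ a) ⬝ᵥ ε ω|)} ≤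
      δ + (Real.exp (-(n : ℝ) / 2) + Real.exp (-(d : ℝ) / 4)) +
        (Real.exp (-(n : ℝ) / 4) + 2 * Real.exp (-(n : ℝ) / 16) +
          2 * Real.exp (-t ^ 2 / (16 * v * c₄ * B))) +
        2 * Real.exp (-t ^ 2 / (2 * v * B)) := by
  have hσ : (0 : ℝ) < σ := by exact_mod_cast hε.sigma_pos
  have hv0 : 0 < v := lt_of_lt_of_le (by positivity) hv
  have hn' : (0 : ℝ) < n := by exact_mod_cast hn
  have : IsProbabilityMeasure (P.map fun ω => entries (whiten S (K ω))) :=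
    Measure.isProbabilityMeasure_map hK.measurable_whiten.aemeasurable
  have h1 := hK.normSq_whiten_mulVec_gt_le (m := n / c₄) (M := c₄ * n) a hδ
  have h2 := hK.measureReal_whiten_le (hK.sphericalLaw.normSq_mulVec_le_le (m := n / c₄)
    (M := c₄ * n) (by positivity) hn ha)
  have h3 := hK.measureReal_whiten_le (hK.sphericalLaw.abs_inner_mulVec_ge_le (m := n / c₄)
    (M := c₄ * n) (B := B) (by positivity) hB hv0 ht hn ha haw hw)
  have h4 := hε.abs_inner_ge_le hK hv hB ht a
  have e1 : -t ^ 2 * n / (16 * v * (c₄ * n) * B) = -t ^ 2 / (16 * v * c₄ * B) := by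
    field_simp
  have e2 : (n : ℝ) / c₄ * d / (16 * n) = d / (16 * c₄) := by
    field_simp
  rw [e1] at h3
  rw [e2] at h2
  refine le_trans ?_ (add_le_add (add_le_add (add_le_add h1 h2) h3) h4)
  refine le_trans ?_ (add_le_add ((measureReal_union_le _ _).trans (add_le_add
    (measureReal_union_le _ _) le_rfl)) le_rfl)
  refine le_trans ?_ (measureReal_union_le _ _)
  refine measureReal_mono (fun ω hω => ?_) (measure_ne_top _ _)
  obtain ⟨hG, hω⟩ := hω
  by_cases hB' : (whiten S (K ω) *ᵥ a) ⬝ᵥ (whiten S (K ω) *ᵥ a) ≤ B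
  · rcases hω with hω | hω | hω
    · exact Or.inl (Or.inl (Or.inr ⟨hG, hω⟩))
    · exact Or.inl (Or.inr ⟨hG, hB', hω⟩)
    · exact Or.inr ⟨hB', hω⟩
  · refine Or.inl (Or.inl (Or.inl ⟨hG, ?_⟩))
    rw [ha, mul_one]
    exact not_le.mp hB'

theorem SpectralConcentration.gramBounds_compl_le [IsProbabilityMeasure P] {c₀ c₄ C₁ : ℝ}
    (hZ : SpectralConcentration P (fun ω => whiten S (K ω)) c₀ c₄ C₁) (hn : 0 < n)
    (hcn : c₀ * d < n) :
    P.real {ω | ¬ GramBounds (n / c₄) (c₄ * n) (whiten S (K ω))} ≤ Real.exp (-C₁ * d) := by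
  refine le_trans (measureReal_mono (fun ω hω => ?_) (measure_ne_top _ _))
    (hZ Finset.univ (by simpa using hcn)).le
  by_contra h
  simp only [Set.mem_ofPred_eq, not_or, not_lt] at h
  exact hω (gramBounds_of_subGram hn h.1 h.2)

/-- Apply spectral concentration to a submatrix with the least admissible number of columns,
`⌊c₀ d⌋ + 1 ≤ n`: any of its columns has squared length `O (d)`, although the whole of `Z` only
gives `O (n)`. -/
theorem SpectralConcentration.exists_col_tail [IsProbabilityMeasure P] {c₀ c₄ C₁ : ℝ}
    (hZ : SpectralConcentration P (fun ω => whiten S (K ω)) c₀ c₄ C₁) (hc₀ : 0 < c₀)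
    (hc₄ : 0 < c₄) (hd : 0 < d) (hcn : c₀ * d < n) :
    ∃ j : Fin n, P.real {ω | c₄ * (c₀ + 1) * d < (whiten S (K ω) *ᵥ Pi.single j 1) ⬝ᵥ
      (whiten S (K ω) *ᵥ Pi.single j 1)} ≤ Real.exp (-C₁ * d) := by
  have hd' : (1 : ℝ) ≤ d := by exact_mod_cast hd
  have hfl : ⌊c₀ * d⌋₊ < n := (Nat.floor_lt (by positivity)).mpr hcn
  obtain ⟨J, -, hJ⟩ := Finset.exists_subset_card_eq (s := (Finset.univ : Finset (Fin n)))
    (n := ⌊c₀ * d⌋₊ + 1) (by simpa using hfl)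
  obtain ⟨j, hj⟩ : J.Nonempty := by
    rw [← Finset.card_pos]
    omega
  have hlow : c₀ * d < J.card := by
    rw [hJ]
    push_cast
    exact Nat.lt_floor_add_one _
  have hup : (J.card : ℝ) ≤ (c₀ + 1) * d := by
    rw [hJ]
    push_cast
    have := Nat.floor_le (a := c₀ * d) (by positivity)
    linarith
  refine ⟨j, le_trans (measureReal_mono (fun ω hω => ?_) (measure_ne_top _ _)) (hZ J hlow).le⟩
  refine Or.inl ?_
  by_contra h
  have h1 := normSq_col_le_of_subGram (not_lt.mp h) hc₄.le hj
  have h2 : c₄ * (J.card : ℝ) ≤ c₄ * ((c₀ + 1) * d) := by gcongr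
  have h3 : c₄ * (c₀ + 1) * d < _ := hω
  rw [mul_assoc] at h3
  exact absurd (h3.trans_le (h1.trans h2)) (lt_irrefl _)

end Tails

/-! ### Bounds implying the screening property -/

/-- If the whitened key `a` has inner product at least `r` with the whitened weights `b`, then
splitting `b` along and across `a` bounds the score of the key below by `r l - 2 t`, where `l`
bounds `|Z a|²` below and `t` bounds the two cross terms. -/
theorem le_score_of_alignment {n d : ℕ} {S : Matrix (Fin n) (Fin n) ℝ} (hS : S.PosDef)
    (A : Matrix (Fin n) (Fin d) ℝ) (e : Fin d → ℝ) (β : Fin n → ℝ) {i : Fin n} {a b : Fin n → ℝ}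
    {r l t : ℝ} (ha : a = whitenedKey S i) (hb : b = CFC.sqrt S *ᵥ β)
    (hr : 0 ≤ r) (hrab : r ≤ a ⬝ᵥ b) (hl0 : 0 ≤ l)
    (hl : l < (whiten S A *ᵥ a) ⬝ᵥ (whiten S A *ᵥ a))
    (hw : |(whiten S A *ᵥ a) ⬝ᵥ (whiten S A *ᵥ (b - (a ⬝ᵥ b) • a))| < t)
    (he : |(whiten S A *ᵥ a) ⬝ᵥ e| < t) :
    r * l - 2 * t ≤ score A (query β A e) i := by
  have hq : query β A e = whiten S A *ᵥ b + e := by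
    rw [query, hb, whiten_mulVec_sqrt_mulVec hS]
  rw [mulVec_sub, mulVec_smul, dotProduct_sub, dotProduct_smul, smul_eq_mul] at hw
  rw [score_eq_dotProduct_whiten hS, ← ha, hq, dotProduct_comm, dotProduct_add]
  have h1 := (abs_lt.mp hw).1
  have h2 := (abs_lt.mp he).1
  have h3 : r * l ≤ (a ⬝ᵥ b) * ((whiten S A *ᵥ a) ⬝ᵥ (whiten S A *ᵥ a)) := by
    have := hr.trans hrab
    gcongr
  linarith

theorem add_dotProduct_add_le {m : Type*} [Fintype m] (x y : m → ℝ) :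
    (x + y) ⬝ᵥ (x + y) ≤ 2 * (x ⬝ᵥ x) + 2 * (y ⬝ᵥ y) := by
  have h := dotProduct_self_nonneg_real (x - y)
  have h1 := dotProduct_comm x y
  simp only [dotProduct_sub, sub_dotProduct, dotProduct_add, add_dotProduct] at h ⊢
  linarith

theorem IsTopK.subset_of_countAboveMin_le_rpow {n d : ℕ} {f : Fin n → ℝ} {M : Finset (Fin n)}
    (hM : M.Nonempty) {c e : ℝ} (hc : 0 ≤ c) (hd : 1 ≤ d)
    (h : countAboveMin f M hM ≤ c * n * (d : ℝ) ^ (-e))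
    {c₂ : ℝ} (hc₂ : c₂ ≤ e) {k : ℕ} (hk : ⌊c * n * (d : ℝ) ^ (-c₂)⌋₊ ≤ k) {T : Finset (Fin n)}
    (hT : IsTopK f k T) : M ⊆ T := by
  refine hT.subset_of_countAboveMin_le hM ?_
  have h1 : countAboveMin f M hM ≤ c * n * (d : ℝ) ^ (-c₂) := by
    refine h.trans ?_
    have hd' : (1 : ℝ) ≤ d := by exact_mod_cast hd
    gcongr
  -- the count is a natural number, so the floor in `hk` loses nothing
  rw [countAboveMin_eq_card] at h1 ⊢
  exact_mod_cast (Nat.le_floor h1).trans hk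

/-- The deterministic core of screening: the scores of the keys in `M` are at least
`2 θ d ^ (1 - κ)`, the squares of all scores sum to `O (n d ^ (1 + τ))`, and the quotient of the
two rates bounds the number of keys scoring above the minimum over `M`. -/
theorem countAboveMin_score_le {n d : ℕ} {S : Matrix (Fin n) (Fin n) ℝ} (hS : S.PosDef)
    (A : Matrix (Fin n) (Fin d) ℝ) (e : Fin d → ℝ) (β : Fin n → ℝ) {M : Finset (Fin n)}
    (hM : M.Nonempty) {κ τ c₄ c₇ v B r θ t : ℝ} (hc₄ : 0 < c₄) (hc₇ : 0 < c₇)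
    (hB : 0 < B) (hr : 0 < r) (hd : 0 < d) (hn : 0 < n)
    (hθ : θ = r / (64 * c₄)) (ht : t = θ * (d : ℝ) ^ (1 - κ))
    (hlam : lamMax S ≤ c₇ * (d : ℝ) ^ τ)
    {b : Fin n → ℝ} (hb : b = CFC.sqrt S *ᵥ β) (hbv : b ⬝ᵥ b ≤ v)
    (hab : ∀ i ∈ M, r / (d : ℝ) ^ κ ≤ whitenedKey S i ⬝ᵥ b)
    (hgram : GramBounds (n / c₄) (c₄ * n) (whiten S A))
    (hZb : (whiten S A *ᵥ b) ⬝ᵥ (whiten S A *ᵥ b) ≤ B * d * (b ⬝ᵥ b))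
    (he : e ⬝ᵥ e ≤ 4 * v * d)
    (hkey : ∀ i ∈ M, d / (16 * c₄) <
        (whiten S A *ᵥ whitenedKey S i) ⬝ᵥ (whiten S A *ᵥ whitenedKey S i) ∧
      |(whiten S A *ᵥ whitenedKey S i) ⬝ᵥ
        (whiten S A *ᵥ (b - (whitenedKey S i ⬝ᵥ b) • whitenedKey S i))| < t ∧
      |(whiten S A *ᵥ whitenedKey S i) ⬝ᵥ e| < t) :
    countAboveMin (score A (query β A e)) M hM ≤
      c₇ * (c₄ * ((2 * B + 8) * v)) / (2 * θ) ^ 2 * n * (d : ℝ) ^ (2 * κ + τ - 1) := by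
  have hd0 : (0 : ℝ) < d := by exact_mod_cast hd
  have hn0 : (0 : ℝ) < n := by exact_mod_cast hn
  have hθ0 : 0 < θ := by rw [hθ]; positivity
  have ht0 : 0 < t := by rw [ht]; positivity
  have hmin : ∀ i ∈ M, 2 * t ≤ score A (query β A e) i := by
    intro i hi
    obtain ⟨h1, h2, h3⟩ := hkey i hi
    refine le_trans (le_of_eq ?_)
      (le_score_of_alignment hS A e β rfl hb (by positivity) (hab i hi) (by positivity) h1 h2 h3)
    -- the leading term is `r d ^ (-κ) * d / (16 c₄) = 4 t`
    rw [ht, hθ, Real.rpow_sub hd0, Real.rpow_one]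
    field_simp
    ring
  have hqq : query β A e ⬝ᵥ query β A e ≤ (2 * B + 8) * v * d := by
    rw [query, ← whiten_mulVec_sqrt_mulVec hS, ← hb]
    refine (add_dotProduct_add_le _ _).trans ?_
    have h1 : B * d * (b ⬝ᵥ b) ≤ B * d * v := by gcongr
    linarith
  have hsum : score A (query β A e) ⬝ᵥ score A (query β A e) ≤
      c₇ * (d : ℝ) ^ τ * (c₄ * n * ((2 * B + 8) * v * d)) :=
    (score_normSq_le hS A _ hgram hlam (by positivity)).trans (by gcongr)
  refine (countAboveMin_le_of_sum_sq_le hM (by positivity : 0 < 2 * t) hmin hsum).trans_eq ?_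
  have hpow : (d : ℝ) ^ (2 * κ + τ - 1) * ((d : ℝ) ^ (1 - κ)) ^ 2 = (d : ℝ) ^ τ * d := by
    rw [← Real.rpow_natCast, ← Real.rpow_mul hd0.le, ← Real.rpow_add hd0,
      ← Real.rpow_add_one hd0.ne']
    congr 1
    push_cast
    ring
  have ht2 : (2 * t) ^ 2 = (2 * θ) ^ 2 * ((d : ℝ) ^ (1 - κ)) ^ 2 := by rw [ht]; ring
  rw [div_eq_iff (by positivity), ht2]
  calc _ = c₇ * (c₄ * ((2 * B + 8) * v)) * n * ((d : ℝ) ^ τ * d) := by ring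
    _ = c₇ * (c₄ * ((2 * B + 8) * v)) / (2 * θ) ^ 2 * (2 * θ) ^ 2 * n *
        ((d : ℝ) ^ (2 * κ + τ - 1) * ((d : ℝ) ^ (1 - κ)) ^ 2) := by
      rw [hpow, div_mul_cancel₀ _ (by positivity)]
    _ = _ := by ring

/-! ### Probability of the exceptional events -/

section Exceptional

variable {Ω : Type*} [MeasurableSpace Ω] {P : Measure Ω} {n d : ℕ}
  {K : Ω → Matrix (Fin n) (Fin d) ℝ} {ε : Ω → Fin d → ℝ} {β : Fin n → ℝ} {σ : ℝ≥0}
  {S : Matrix (Fin n) (Fin n) ℝ}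

/-- The outcomes excluded by the argument for the keys in `M`: the Gram bounds fail, the query is
too long, or some key of `M` has a short whitened image or a large cross term. -/
def exceptionalSet (K : Ω → Matrix (Fin n) (Fin d) ℝ) (ε : Ω → Fin d → ℝ)
    (S : Matrix (Fin n) (Fin n) ℝ) (M : Finset (Fin n)) (b : Fin n → ℝ) (c₄ v B t : ℝ) : Set Ω :=
  {ω | ¬ GramBounds (n / c₄) (c₄ * n) (whiten S (K ω))} ∪
  {ω | GramBounds (n / c₄) (c₄ * n) (whiten S (K ω)) ∧
    B * d * (b ⬝ᵥ b) < (whiten S (K ω) *ᵥ b) ⬝ᵥ (whiten S (K ω) *ᵥ b)} ∪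
  {ω | 4 * v * d < ε ω ⬝ᵥ ε ω} ∪
  ⋃ i ∈ M, {ω | GramBounds (n / c₄) (c₄ * n) (whiten S (K ω)) ∧
    ((whiten S (K ω) *ᵥ whitenedKey S i) ⬝ᵥ (whiten S (K ω) *ᵥ whitenedKey S i) ≤
        d / (16 * c₄) ∨
      t ≤ |(whiten S (K ω) *ᵥ whitenedKey S i) ⬝ᵥ
        (whiten S (K ω) *ᵥ (b - (whitenedKey S i ⬝ᵥ b) • whitenedKey S i))| ∨
      t ≤ |(whiten S (K ω) *ᵥ whitenedKey S i) ⬝ᵥ ε ω|)}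

theorem measureReal_exceptionalSet_le [IsProbabilityMeasure P] (hε : GaussianNoise P K ε σ)
    (hK : StandardizedKeys P K S) {c₀ c₄ C₁ v θ C x t : ℝ}
    (hZ : SpectralConcentration P (fun ω => whiten S (K ω)) c₀ c₄ C₁)
    {M : Finset (Fin n)} (hM : M.Nonempty) {b : Fin n → ℝ} (hbv : b ⬝ᵥ b ≤ v)
    (hσv : (σ : ℝ) ^ 2 ≤ v) (hc₀ : 1 < c₀) (hc₄ : 0 < c₄) (hd : 0 < d) (hcn : c₀ * d < n)
    (hC : 0 < C) (hC1 : C ≤ C₁) (hC2 : C ≤ 1 / 16)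
    (hC3 : C ≤ θ ^ 2 / (16 * v * c₄ * (c₄ * (c₀ + 1))))
    (hC4 : C ≤ θ ^ 2 / (2 * v * (c₄ * (c₀ + 1))))
    (hx0 : 0 < x) (hxd : x ≤ d) (ht0 : 0 < t) (ht2 : t ^ 2 = θ ^ 2 * (x * d)) :
    P.real (exceptionalSet K ε S M b c₄ v (c₄ * (c₀ + 1)) t) ≤
      13 * (M.card * Real.exp (-C * x)) := by
  obtain ⟨B, hBdef⟩ : ∃ B, B = c₄ * (c₀ + 1) := ⟨_, rfl⟩
  have hB : 0 < B := by rw [hBdef]; positivity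
  rw [← hBdef] at hC3 hC4 ⊢
  have hσ : (0 : ℝ) < σ := by exact_mod_cast hε.sigma_pos
  have hv : 0 < v := lt_of_lt_of_le (by positivity) hσv
  have hd0 : (0 : ℝ) < d := by exact_mod_cast hd
  have hdn : (d : ℝ) ≤ n := by nlinarith
  have hn0 : (0 : ℝ) < n := by linarith
  have hn : 0 < n := by exact_mod_cast hn0
  set E := Real.exp (-C * x) with hE
  have hE0 : 0 < E := Real.exp_pos _
  have hexp : ∀ y : ℝ, y ≤ -C * x → Real.exp y ≤ E := fun y hy => Real.exp_le_exp.mpr hy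
  have hE1 : Real.exp (-C₁ * d) ≤ E := hexp _ (by nlinarith)
  have hCx : C * x ≤ 1 / 16 * d := by gcongr
  have hEd4 : Real.exp (-(d : ℝ) / 4) ≤ E := hexp _ (by linarith)
  have hEd2 : Real.exp (-(d : ℝ) / 2) ≤ E := hexp _ (by linarith)
  have hEn2 : Real.exp (-(n : ℝ) / 2) ≤ E := hexp _ (by linarith)
  have hEn4 : Real.exp (-(n : ℝ) / 4) ≤ E := hexp _ (by linarith)
  have hEn16 : Real.exp (-(n : ℝ) / 16) ≤ E := hexp _ (by linarith)
  have hEin : Real.exp (-t ^ 2 / (16 * v * c₄ * (B * d))) ≤ E := by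
    refine hexp _ ?_
    rw [ht2, neg_div, neg_mul, neg_le_neg_iff]
    calc C * x ≤ θ ^ 2 / (16 * v * c₄ * B) * x := by gcongr
      _ = _ := by field_simp
  have hEno : Real.exp (-t ^ 2 / (2 * v * (B * d))) ≤ E := by
    refine hexp _ ?_
    rw [ht2, neg_div, neg_mul, neg_le_neg_iff]
    calc C * x ≤ θ ^ 2 / (2 * v * B) * x := by gcongr
      _ = _ := by field_simp
  obtain ⟨j, hj⟩ := hZ.exists_col_tail (zero_lt_one.trans hc₀) hc₄ hd hcn
  rw [← hBdef] at hj
  have hM1 : (1 : ℝ) ≤ M.card := by exact_mod_cast Finset.card_pos.mpr hM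
  refine (measureReal_union_le _ _).trans ?_
  have h1 := (measureReal_union_le (μ := P) _ _).trans (add_le_add ((measureReal_union_le (μ := P)
    _ _).trans (add_le_add ((hZ.gramBounds_compl_le hn hcn).trans hE1)
      ((hK.normSq_whiten_mulVec_gt_le (m := n / c₄)
        (M := c₄ * n) b hj).trans hE1))) ((hε.normSq_gt_le hσv).trans hEd2))
  have h2 := (measureReal_biUnion_finset_le (μ := P) M _).trans (Finset.sum_le_sum fun i _ =>
    (hK.direction_tail hε hc₄ hσv (by positivity) ht0 hn hj (hK.whitenedKey_normSq i)
      (dotProduct_sub_proj (hK.whitenedKey_normSq i) b)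
      ((normSq_sub_proj_le (hK.whitenedKey_normSq i) b).trans hbv)))
  rw [Finset.sum_const, nsmul_eq_mul] at h2
  refine (add_le_add h1 h2).trans ?_
  have h3 : Real.exp (-C₁ * d) + (Real.exp (-(n : ℝ) / 2) + Real.exp (-(d : ℝ) / 4)) +
        (Real.exp (-(n : ℝ) / 4) + 2 * Real.exp (-(n : ℝ) / 16) +
          2 * Real.exp (-t ^ 2 / (16 * v * c₄ * (B * d)))) +
        2 * Real.exp (-t ^ 2 / (2 * v * (B * d))) ≤ 10 * E := by linarith
  have h4 : E ≤ M.card * E := le_mul_of_one_le_left hE0.le hM1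
  have h5 := mul_le_mul_of_nonneg_left h3 (zero_le_one.trans hM1)
  linarith

end Exceptional

/-! ### The screening theorem -/

theorem lemma3 (κ τ c₀ c₄ C₁ c₅ c₆ c₇ v : ℝ) (hκ : 0 ≤ κ) (hτ₀ : 0 ≤ τ) (hτ₁ : τ < 1)
    (hκτ : 2 * κ + τ < 1) (hc₀ : 1 < c₀) (hc₄ : 1 < c₄) (hC₁ : 0 < C₁) (hc₅ : 0 < c₅)
    (hc₆ : 0 < c₆) (hc₇ : 0 < c₇) (hv : 0 < v) :
    ∃ c C A : ℝ, 0 < c ∧ 0 < C ∧ 0 < A ∧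
      ∀ (d n s : ℕ), 2 ≤ d → c₀ * d < n →
      ∀ {Ω : Type*} [MeasurableSpace Ω] (P : Measure Ω) [IsProbabilityMeasure P]
        (K : Ω → Matrix (Fin n) (Fin d) ℝ) (ε : Ω → Fin d → ℝ) (β : Fin n → ℝ) (σ : ℝ≥0)
        (S : Matrix (Fin n) (Fin n) ℝ) (hβ : β ∈ stdSimplex ℝ (Fin n)),
        (relevant β).card = s →
        GaussianNoise P K ε σ →
        StandardizedKeys P K S →
        SpectralConcentration P (fun ω => whiten S (K ω)) c₀ c₄ C₁ →
        SignalStrength P K ε β κ v c₅ c₆ →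
        lamMax S ≤ c₇ * (d : ℝ) ^ τ →
        1 - A * (s * Real.exp (-C * (d : ℝ) ^ (1 - 2 * κ) / Real.log d)) ≤
          P.real {ω |
            countAboveMin (score (K ω) (query β (K ω) (ε ω))) (relevant β) (relevant_nonempty hβ)
              ≤ c * n * (d : ℝ) ^ (2 * κ + τ - 1) ∧
            ∀ c₂ : ℝ, 0 < c₂ → c₂ ≤ 1 - 2 * κ - τ →
              ∀ k : ℕ, ⌊c * n * (d : ℝ) ^ (-c₂)⌋₊ ≤ k →
                ∀ T : Finset (Fin n), IsTopK (score (K ω) (query β (K ω) (ε ω))) k T →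
                  relevant β ⊆ T} := by
  obtain ⟨B, hBdef⟩ : ∃ B, B = c₄ * (c₀ + 1) := ⟨_, rfl⟩
  have hB : 0 < B := by rw [hBdef]; positivity
  obtain ⟨r, hrdef⟩ : ∃ r, r = c₅ * c₆ := ⟨_, rfl⟩
  have hr : 0 < r := by rw [hrdef]; positivity
  obtain ⟨θ, hθdef⟩ : ∃ θ, θ = r / (64 * c₄) := ⟨_, rfl⟩
  have hθ : 0 < θ := by rw [hθdef]; positivity
  obtain ⟨C, hC, hC1, hC2, hC3, hC4⟩ : ∃ C : ℝ, 0 < C ∧ C ≤ C₁ ∧ C ≤ 1 / 16 ∧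
      C ≤ θ ^ 2 / (16 * v * c₄ * B) ∧ C ≤ θ ^ 2 / (2 * v * B) := by
    refine ⟨min (min C₁ (1 / 16)) (min (θ ^ 2 / (16 * v * c₄ * B)) (θ ^ 2 / (2 * v * B))),
      ?_, ?_, ?_, ?_, ?_⟩
    · have h1 : 0 < θ ^ 2 / (16 * v * c₄ * B) := by positivity
      have h2 : 0 < θ ^ 2 / (2 * v * B) := by positivity
      have h3 : (0 : ℝ) < 1 / 16 := by norm_num
      exact lt_min (lt_min hC₁ h3) (lt_min h1 h2)
    · exact (min_le_left _ _).trans (min_le_left _ _)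
    · exact (min_le_left _ _).trans (min_le_right _ _)
    · exact (min_le_right _ _).trans (min_le_left _ _)
    · exact (min_le_right _ _).trans (min_le_right _ _)
  -- the factor `log 2` absorbs the division by `log d ≥ log 2`
  refine ⟨c₇ * (c₄ * ((2 * B + 8) * v)) / (2 * θ) ^ 2, C * Real.log 2, 13, by positivity,
    mul_pos hC (Real.log_pos one_lt_two), by norm_num, ?_⟩
  intro d n s hd hcn Ω _ P _ K ε β σ S hβ hs hε hK hZ hq hS
  have hd1 : (1 : ℝ) ≤ d := by exact_mod_cast (by omega : 1 ≤ d)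
  have hd0 : (0 : ℝ) < d := by linarith
  have hn0 : (0 : ℝ) < n := by nlinarith
  have hn : 0 < n := by exact_mod_cast hn0
  obtain ⟨x, hx⟩ : ∃ x, x = (d : ℝ) ^ (1 - 2 * κ) := ⟨_, rfl⟩
  have hx0 : 0 < x := by rw [hx]; positivity
  have hxd : x ≤ d := by
    rw [hx]
    calc (d : ℝ) ^ (1 - 2 * κ) ≤ (d : ℝ) ^ (1 : ℝ) :=
          Real.rpow_le_rpow_of_exponent_le hd1 (by linarith)
      _ = d := Real.rpow_one _
  obtain ⟨t, ht⟩ : ∃ t, t = θ * (d : ℝ) ^ (1 - κ) := ⟨_, rfl⟩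
  have ht0 : 0 < t := by rw [ht]; positivity
  have ht2 : t ^ 2 = θ ^ 2 * (x * d) := by
    rw [ht, mul_pow, hx, ← Real.rpow_natCast ((d : ℝ) ^ (1 - κ)), ← Real.rpow_mul hd0.le,
      ← Real.rpow_add_one hd0.ne']
    congr 2
    push_cast
    ring
  obtain ⟨b, hb⟩ : ∃ b, b = CFC.sqrt S *ᵥ β := ⟨_, rfl⟩
  have hbσ := normSq_add_noise_le hε hK hq (by omega)
  rw [← hb] at hbσ
  have hbv : b ⬝ᵥ b ≤ v := by linarith [sq_nonneg (σ : ℝ)]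
  have hσv : (σ : ℝ) ^ 2 ≤ v := by linarith [dotProduct_self_nonneg_real b]
  have hab : ∀ i ∈ relevant β, r / (d : ℝ) ^ κ ≤ whitenedKey S i ⬝ᵥ b := by
    intro i hi
    rw [hrdef, hb]
    exact le_whitenedKey_dotProduct hε hK hq hc₆.le (by omega) hi
  have hbad := measureReal_exceptionalSet_le hε hK hZ (relevant_nonempty hβ) hbv hσv hc₀
    (zero_lt_one.trans hc₄) (by omega) hcn hC hC1 hC2 (hBdef ▸ hC3) (hBdef ▸ hC4) hx0 hxd ht0 ht2
  rw [← hBdef, hs] at hbad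
  have hEle : Real.exp (-C * x) ≤ Real.exp (-(C * Real.log 2) * x / Real.log d) := by
    refine Real.exp_le_exp.mpr ?_
    have hl2 := Real.log_pos one_lt_two
    have hld : Real.log 2 ≤ Real.log d :=
      Real.log_le_log two_pos (by exact_mod_cast hd)
    rw [neg_mul, neg_mul, neg_div, neg_le_neg_iff, div_le_iff₀ (by linarith)]
    calc C * Real.log 2 * x = C * x * Real.log 2 := by ring
      _ ≤ C * x * Real.log d := by gcongr
  rw [← hx]
  set Good : Set Ω := _
  change _ ≤ P.real Good
  -- subadditivity of the outer measure suffices: `Good` need not be measurable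
  have hcover : 1 ≤ P.real (exceptionalSet K ε S (relevant β) b c₄ v B t) + P.real Good := by
    refine le_trans ?_ (measureReal_union_le _ _)
    rw [← probReal_univ (μ := P)]
    refine measureReal_mono (fun ω _ => ?_) (measure_ne_top _ _)
    by_cases hω : ω ∈ exceptionalSet K ε S (relevant β) b c₄ v B t
    · exact Or.inl hω
    refine Or.inr ?_
    simp only [exceptionalSet, Set.mem_union, Set.mem_iUnion, not_or, not_exists] at hω
    obtain ⟨⟨⟨hωG, hωU⟩, hωV⟩, hωD⟩ := hω
    have hg : GramBounds (n / c₄) (c₄ * n) (whiten S (K ω)) := not_not.mp hωG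
    have hcount := countAboveMin_score_le hK.posDef (K ω) (ε ω) β (relevant_nonempty hβ)
      (zero_lt_one.trans hc₄) hc₇ hB hr (by omega) hn hθdef ht hS hb hbv hab hg
      (not_lt.mp fun h => hωU ⟨hg, h⟩) (not_lt.mp hωV) (fun i hi => by
        have h1 := not_and.mp (hωD i hi) hg
        rwa [not_or, not_or, not_le, not_le, not_le] at h1)
    refine ⟨hcount, fun c₂ _ hc₂ k hk T hT => ?_⟩
    refine IsTopK.subset_of_countAboveMin_le_rpow (relevant_nonempty hβ) (e := 1 - 2 * κ - τ)
      (by positivity) (by omega : 1 ≤ d) ?_ hc₂ hk hT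
    rwa [show -(1 - 2 * κ - τ) = 2 * κ + τ - 1 by ring]
  have hfin : 13 * (s * Real.exp (-C * x)) ≤
      13 * (s * Real.exp (-(C * Real.log 2) * x / Real.log d)) := by
    gcongr
  linarith
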